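/- Let $S\subset\mathbb{R}^3$ be the L-solid, the union of the three unit cubes $[0,1]^3$ (middle), $[0,1]\times[1,2]\times[0,1]$ (top) and $[1,2]\times[0,1]\times[0,1]$ (right). The L-solid translation $3$-manifold $\mathcal{M}$ is the quotient of $S$ obtained by identifying opposite boundary faces by perpendicular translation: $(0,y,z)\sim(1,y,z)$ for $1\le y\le 2$; $(0,y,z)\sim(2,y,z)$ for $0\le y\le 1$; $(x,0,z)\sim(x,2,z)$ for $0\le x\le 1$; $(x,0,z)\sim(x,1,z)$ for $1\le x\le 2$ (in each case with $0\le z\le1$); and $(x,y,0)\sim(x,y,1)$ for all $(x,y,0)\in S$. Let $\lambda_3$ denote Lebesgue measure on $\mathcal{M}$, so that $\lambda_3(\mathcal{M})=3$. The singular points of $\mathcal{M}$ are the images of the edges of the three cubes that are parallel to the $z$-axis. Theorem. Let $\mathbf{v}=(v_1,v_2,v_3)\in\mathbb{R}^3$ be a Kronecker direction, that is, $v_1,v_2,v_3$ are linearly independent over $\mathbb{Q}$. Then every half-infinite geodesic $\mathcal{L}(t)$, $t\ge0$, in $\mathcal{M}$ with constant velocity $\mathbf{v}$ that does not hit a singular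 point is uniformly distributed in $\mathcal{M}$: for every continuous function $f:\mathcal{M}\to\mathbb{R}$, $$\lim_{T\to\infty}\frac1T\int_0^T f(\mathcal{L}(t))\,\mathrm{d}t=\frac13\int_{\mathcal{M}}f\,\mathrm{d}\lambda_3 .$$ -/

import Mathlib

open MeasureTheory Filter Topology Set

noncomputable section

namespace LManifold

/-- The L-solid in `ℝ³`: the union of the middle cube `[0,1]³`, the top cube
`[0,1] × [1,2] × [0,1]` and the right cube `[1,2] × [0,1] × [0,1]`. -/
def solid : Set (Fin 3 → ℝ) :=
  Icc ![0, 0, 0] ![1, 1, 1] ∪ Icc ![0, 1, 0] ![1, 2, 1] ∪ Icc ![1, 0, 0] ![2, 1, 1]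

/-- Face identification by perpendicular translation: `FaceRel p q` holds when `p` lies on a
boundary face of the solid and `q` is the corresponding point of the opposite face. -/
inductive FaceRel : solid → solid → Prop
  /-- The left and the right `X`-face of the top cube. -/
  | xTop (p q : solid) (hp : p.1 0 = 0) (hy : 1 ≤ p.1 1)
      (hq : q.1 = ![1, p.1 1, p.1 2]) : FaceRel p q
  /-- The left `X`-face of the middle cube and the right `X`-face of the right cube. -/
  | xBottom (p q : solid) (hp : p.1 0 = 0) (hy : p.1 1 ≤ 1)
      (hq : q.1 = ![2, p.1 1, p.1 2]) : FaceRel p q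
  /-- The bottom `Y`-face of the middle cube and the top `Y`-face of the top cube. -/
  | yLeft (p q : solid) (hp : p.1 1 = 0) (hx : p.1 0 ≤ 1)
      (hq : q.1 = ![p.1 0, 2, p.1 2]) : FaceRel p q
  /-- The bottom and the top `Y`-face of the right cube. -/
  | yRight (p q : solid) (hp : p.1 1 = 0) (hx : 1 ≤ p.1 0)
      (hq : q.1 = ![p.1 0, 1, p.1 2]) : FaceRel p q
  /-- The front and the back `Z`-face of each cube. -/
  | z (p q : solid) (hp : p.1 2 = 0) (hq : q.1 = ![p.1 0, p.1 1, 1]) : FaceRel p q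

/-- The L-solid translation `3`-manifold: the quotient of the solid by the equivalence relation
generated by the face identifications. -/
def Manifold : Type := Quot FaceRel

/-- The quotient topology. -/
instance : TopologicalSpace Manifold := inferInstanceAs (TopologicalSpace (Quot FaceRel))

/-- The Borel `σ`-algebra. -/
instance : MeasurableSpace Manifold := borel Manifold

instance : BorelSpace Manifold := ⟨rfl⟩

/-- The quotient map from the solid onto the manifold. -/
def proj (p : solid) : Manifold := Quot.mk FaceRel p

/-- Lebesgue measure `λ₃` on the manifold (of total mass `3`). -/
def leb : Measure Manifold := Measure.map proj ((volume : Measure (Fin 3 → ℝ)).comap Subtype.val)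

/-- The singular points: the image of the edges of the atomic cubes that are parallel to the
`z`-axis, that is, of the points whose `x`- and `y`-coordinates are both integers. (These eight
edges are all identified with each other, and the total angle around their image is `6π`; the
manifold is flat around all its other points.) -/
def singular : Set Manifold :=
  {m | ∃ p : solid, proj p = m ∧ (∃ i : ℤ, p.1 0 = i) ∧ (∃ j : ℤ, p.1 1 = j)}

/-- On the time interval `[a, b]`, the path `γ` is the image of a line segment inside the solid,
traversed with constant velocity `v`. -/
def StraightOn (v : Fin 3 → ℝ) (γ : ℝ → Manifold) (a b : ℝ) : Prop :=
  ∃ q : Fin 3 → ℝ, ∀ t ∈ Icc a b, ∃ h : q + (t - a) • v ∈ solid, γ t = proj ⟨q + (t - a) • v, h⟩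

/-- `γ t`, `t ≥ 0`, is a half-infinite geodesic with constant velocity `v`: locally, to both sides
of every time, it is a line segment with direction `v`. (The values `γ t` for `t < 0` play no
role. For a unit vector `v` this is the parametrization by arc length.) -/
def IsHalfInfiniteGeodesic (v : Fin 3 → ℝ) (γ : ℝ → Manifold) : Prop :=
  (∀ t, 0 ≤ t → ∃ b, t < b ∧ StraightOn v γ t b) ∧
    ∀ t, 0 < t → ∃ a, 0 ≤ a ∧ a < t ∧ StraightOn v γ a t

/-- The coordinates of `v` are linearly independent over `ℚ`. -/
def IsKroneckerDirection (v : Fin 3 → ℝ) : Prop := LinearIndependent ℚ v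

/-- `γ t`, `t ≥ 0`, is uniformly distributed: time averages of continuous functions converge to
their averages over the manifold. -/
def IsUniformlyDistributed (γ : ℝ → Manifold) : Prop :=
  ∀ f : C(Manifold, ℝ),
    Tendsto (fun T : ℝ => (1 / T) * ∫ t in (0 : ℝ)..T, f (γ t)) atTop
      (𝓝 ((1 / 3) * ∫ m, f m ∂leb))

end LManifold

end

/-! Reflecting coordinates makes all components of the velocity positive. The flow then crosses the
faces `y ∈ ℤ`, which form three copies of a 2-torus, and its first return map `step` translates the
torus by (α, β) = (|v₀|/|v₁|, |v₂|/|v₁|) while permuting the three sheets according to the number of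
x-faces crossed. The theorem reduces to equidistribution of every orbit of this skew product,
applied at each height s between two crossings and then integrated over s.

Ergodicity (`ergodic_step`). The translation of the torus is ergodic, so the fibres of an invariant
set have almost everywhere a constant number of elements. Suppose this number is 1 or 2, and compare
the fibre over p with the fibre over p shifted by δ in the x-direction. When the two points pass a
singular edge on different sides, their sheets undergo permutations that differ by a conjugate of
the commutator of the x- and y-gluings, a 3-cycle. Hence the fibres disagree just before or just
after the passage, and the disagreement persists along the orbit until the next passage. If every jα
with 1 ≤ j ≤ n has distance at least δ from the integers, it persists for n steps, so the
disagreement set has measure at least nδ/2 (`le_measure_ne_translate`). There are arbitrarily small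
δ with nδ ≥ 1/4 (`exists_separated_multiples`), but the measure of the disagreement set tends to 0
with δ, a contradiction.

From ergodicity to every orbit (`tendsto_empirical`). A limit of empirical measures projects to a
translation-invariant measure on the torus, hence to Lebesgue measure. So it does not charge the
discontinuities of `step`, is invariant, and is absolutely continuous with respect to the section
measure; ergodicity identifies it.

Geometry (`follow_segment`, `exists_section_orbit`). A nonsingular point of the quotient has only
one description from which motion in direction v can continue, so an abstract geodesic follows the
orbit of `step`. -/

noncomputable section

namespace LManifold

/-! ### Best approximations of an irrational number. -/

/-- Infinitely many scales `n` at which the multiples `jα`, `1 ≤ j ≤ n`, are `δ`-separated from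
the integers with `δ` comparable to `1 / n`. -/
theorem exists_separated_multiples {α : ℝ} (hα : Irrational α) {ε : ℝ} (hε : 0 < ε) :
    ∃ (n : ℕ) (δ : ℝ), 1 ≤ n ∧ 0 < δ ∧ δ < ε ∧ 1 / 4 ≤ n * δ ∧
      ∀ j : ℕ, 1 ≤ j → j ≤ n → ∀ k : ℤ, δ ≤ |j * α - k| := by
  set f : ℕ → ℝ := fun j => |j * α - round (j * α)| with hf
  have hpos : ∀ j : ℕ, 1 ≤ j → 0 < f j := by
    intro j hj
    refine abs_pos.2 (sub_ne_zero.2 fun h => ?_)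
    exact ((irrational_natCast_mul_iff.2 ⟨by omega, hα⟩).ne_int _) h
  have hsmall : ∀ η : ℝ, 0 < η → ∃ j : ℕ, 1 ≤ j ∧ f j < η := by
    intro η hη
    obtain ⟨N, hN⟩ := exists_nat_one_div_lt hη
    obtain ⟨k, hk, -, hk'⟩ := Real.exists_nat_abs_mul_sub_round_le α (n := N + 1) (by omega)
    refine ⟨k, hk, hk'.trans_lt (lt_of_le_of_lt ?_ hN)⟩
    push_cast
    apply one_div_le_one_div_of_le <;> linarith [Nat.cast_nonneg (α := ℝ) N]
  obtain ⟨m₀, hm₀, hm₀ε⟩ := hsmall ε hε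
  -- `m` minimizes `f` up to `m₀`, and `N` below is the first index with a smaller value; they play
  -- the role of consecutive denominators of best approximations. The scale will be `δ = f m`, `n =
  -- N - 1`.
  obtain ⟨m, hm, hmin⟩ := Finset.exists_min_image (Finset.Icc 1 m₀) f ⟨m₀, by simp; omega⟩
  rw [Finset.mem_Icc] at hm
  have hex := hsmall (f m) (hpos m hm.1)
  classical
  set N := Nat.find hex with hN
  obtain ⟨hN1, hNlt⟩ := Nat.find_spec hex
  rw [← hN] at hN1 hNlt
  have hlt : ∀ j : ℕ, 1 ≤ j → j < N → f m ≤ f j := by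
    intro j hj hjN
    by_contra h
    exact Nat.find_min hex hjN ⟨hj, not_le.1 h⟩
  have hmN : m < N := by
    by_contra h
    exact absurd (hmin N (by rw [Finset.mem_Icc]; omega)) (not_le.2 hNlt)
  -- The approximating fractions of denominators `m` and `N` are distinct, so the integer
  -- determinant `D` is nonzero, while `|D| ≤ N * f m + m * f N`.
  have hdet : 1 ≤ 2 * N * f m := by
    set D : ℤ := m * round (N * α) - N * round (m * α) with hD
    have hDeq : (D : ℝ) = N * (m * α - round (m * α)) - m * (N * α - round (N * α)) := by
      rw [hD]; push_cast; ring
    have hmN' : (m : ℝ) < N := by exact_mod_cast hmN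
    have hm0 : (0 : ℝ) ≤ m := Nat.cast_nonneg m
    have hfm := hpos m hm.1
    have hD0 : D ≠ 0 := by
      intro h0
      rw [h0, Int.cast_zero] at hDeq
      have h1 : (N : ℝ) * f m = m * f N := by
        have : (N : ℝ) * (m * α - round (m * α)) = m * (N * α - round (N * α)) := by linarith
        have h2 := congrArg abs this
        rwa [abs_mul, abs_mul, Nat.abs_cast, Nat.abs_cast] at h2
      nlinarith
    have h1 : (1 : ℝ) ≤ |(D : ℝ)| := by exact_mod_cast Int.one_le_abs hD0
    have h2 : |(D : ℝ)| ≤ N * f m + m * f N := by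
      rw [hDeq]
      refine (abs_sub _ _).trans ?_
      rw [abs_mul, abs_mul, Nat.abs_cast, Nat.abs_cast]
    have : (m : ℝ) * f N ≤ N * f m := by
      apply mul_le_mul hmN'.le hNlt.le (hpos N hN1).le (by linarith)
    linarith
  refine ⟨N - 1, f m, by omega, hpos m hm.1, ?_, ?_, ?_⟩
  · exact (hmin m₀ (by simp; omega)).trans_lt hm₀ε
  -- Since `N - 1 ≥ N / 2`, replacing `N` by `N - 1` turns the bound 1/2 into 1/4.
  · have h2 : (2 : ℝ) ≤ N := by exact_mod_cast (by omega : 2 ≤ N)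
    have hfm := hpos m hm.1
    rw [Nat.cast_sub hN1]
    push_cast
    nlinarith
  · intro j hj hjN k
    exact (hlt j hj (by omega)).trans (round_le _ _)

/-! ### Unique ergodicity of torus translations. -/

instance isProbabilityMeasure_volume_unitAddCircle :
    IsProbabilityMeasure (volume : Measure UnitAddCircle) :=
  ⟨by simp [AddCircle.measure_univ]⟩

/-- A translation of the torus that no nontrivial character annihilates is uniquely ergodic. -/
theorem eq_volume_of_invariant {a : UnitAddTorus (Fin 2)}
    (ha : ∀ k : Fin 2 → ℤ, k ≠ 0 → UnitAddTorus.mFourier k a ≠ 1)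
    (ν : Measure (UnitAddTorus (Fin 2))) [IsProbabilityMeasure ν]
    (hν : MeasurePreserving (fun p => p + a) ν ν) : ν = volume := by
  -- Invariance multiplies the k-th Fourier coefficient by the value of the k-th character at `a`,
  -- so only the coefficient at 0 survives; density of trigonometric polynomials then determines the
  -- measure.
  have key : ∀ (μ : Measure (UnitAddTorus (Fin 2))) [IsProbabilityMeasure μ],
      MeasurePreserving (fun p => p + a) μ μ → ∀ k : Fin 2 → ℤ,
      ∫ p, UnitAddTorus.mFourier k p ∂μ = if k = 0 then 1 else 0 := by
    intro μ _ hμ k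
    split_ifs with hk
    · subst hk
      simp [UnitAddTorus.mFourier_zero]
    · have h1 : ∫ p, UnitAddTorus.mFourier k (p + a) ∂μ = ∫ p, UnitAddTorus.mFourier k p ∂μ :=
        hμ.integral_comp (measurableEmbedding_addRight a) _
      have h2 : ∀ p, UnitAddTorus.mFourier k (p + a)
          = UnitAddTorus.mFourier k p * UnitAddTorus.mFourier k a := by
        intro p
        simp only [UnitAddTorus.mFourier, ContinuousMap.coe_mk, ← Finset.prod_mul_distrib]
        refine Finset.prod_congr rfl fun i _ => ?_
        simp [fourier_apply, smul_add, AddCircle.toCircle_add]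
      simp_rw [h2] at h1
      rw [integral_mul_const] at h1
      have h3 : (∫ p, UnitAddTorus.mFourier k p ∂μ) * (UnitAddTorus.mFourier k a - 1) = 0 := by
        rw [mul_sub, h1]; ring
      exact (mul_eq_zero.1 h3).resolve_right (sub_ne_zero.2 (ha k hk))
  have hvol : MeasurePreserving (fun p : UnitAddTorus (Fin 2) => p + a) volume volume :=
    measurePreserving_add_right volume a
  have hint : ∀ (μ : Measure (UnitAddTorus (Fin 2))) [IsProbabilityMeasure μ]
      (g : C(UnitAddTorus (Fin 2), ℂ)), Integrable g μ := fun μ _ g =>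
    (BoundedContinuousFunction.mkOfCompact g).integrable μ
  have hcont : ∀ (μ : Measure (UnitAddTorus (Fin 2))) [IsProbabilityMeasure μ],
      Continuous fun g : C(UnitAddTorus (Fin 2), ℂ) => ∫ p, g p ∂μ := by
    intro μ _
    refine (LipschitzWith.of_dist_le_mul (K := 1) fun g h => ?_).continuous
    rw [dist_eq_norm, dist_eq_norm, ← integral_sub (hint μ g) (hint μ h), NNReal.coe_one, one_mul]
    refine (norm_integral_le_of_norm_le_const (C := ‖g - h‖)
      (ae_of_all _ fun p => (g - h).norm_coe_le_norm p)).trans ?_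
    simp
  have hall : ∀ g : C(UnitAddTorus (Fin 2), ℂ), ∫ p, g p ∂ν = ∫ p, g p := by
    let V : Submodule ℂ C(UnitAddTorus (Fin 2), ℂ) :=
      { carrier := {g | ∫ p, g p ∂ν = ∫ p, g p}
        add_mem' := by
          intro g h hg hh
          simp only [Set.mem_ofPred_eq, ContinuousMap.add_apply] at *
          rw [integral_add (hint _ _) (hint _ _), integral_add (hint _ _) (hint _ _), hg, hh]
        zero_mem' := by simp
        smul_mem' := by
          intro c g hg
          simp only [Set.mem_ofPred_eq, ContinuousMap.smul_apply] at *
          rw [integral_smul, integral_smul, hg] }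
    have hVc : IsClosed (V : Set C(UnitAddTorus (Fin 2), ℂ)) :=
      isClosed_eq (hcont ν) (hcont volume)
    have hV : (Submodule.span ℂ (range (UnitAddTorus.mFourier (d := Fin 2)))) ≤ V := by
      rw [Submodule.span_le]
      rintro _ ⟨k, rfl⟩
      exact (key ν hν k).trans (key volume hvol k).symm
    have := Submodule.topologicalClosure_minimal _ hV hVc
    rw [UnitAddTorus.span_mFourier_closure_eq_top] at this
    exact fun g => this (Submodule.mem_top (x := g))
  refine ext_of_forall_integral_eq_of_IsFiniteMeasure fun g => ?_
  have := hall ⟨fun p => (g p : ℂ), by fun_prop⟩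
  simp only [ContinuousMap.coe_mk] at this
  exact Complex.ofReal_injective
    ((integral_ofReal (𝕜 := ℂ)).symm.trans (this.trans (integral_ofReal (𝕜 := ℂ))))

/-- A unique invariant probability measure is an extreme point of the set of invariant ones, hence
ergodic. -/
theorem ergodic_add_right_torus {a : UnitAddTorus (Fin 2)}
    (ha : ∀ k : Fin 2 → ℤ, k ≠ 0 → UnitAddTorus.mFourier k a ≠ 1) :
    Ergodic (fun p : UnitAddTorus (Fin 2) => p + a) volume := by
  refine Ergodic.of_mem_extremePoints ⟨⟨measurePreserving_add_right volume a, inferInstance⟩, ?_⟩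
  rintro ν ⟨hν, hν'⟩ _ _ _
  exact eq_volume_of_invariant ha ν hν

/-- Linear independence of `1, α, β` over `ℚ`, in terms of characters. -/
theorem mFourier_ne_one {α β : ℝ} (h : ∀ k l m : ℤ, k * α + l * β + m = 0 → k = 0 ∧ l = 0)
    (k : Fin 2 → ℤ) (hk : k ≠ 0) :
    UnitAddTorus.mFourier k ![(α : UnitAddCircle), (β : UnitAddCircle)] ≠ 1 := by
  intro h1
  have h2 : UnitAddTorus.mFourier k ![(α : UnitAddCircle), (β : UnitAddCircle)]
      = ((AddCircle.toCircle ((k 0 * α + k 1 * β : ℝ) : UnitAddCircle) : Circle) : ℂ) := by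
    simp only [UnitAddTorus.mFourier, ContinuousMap.coe_mk, Fin.prod_univ_two, fourier_apply,
      Matrix.cons_val_zero, Matrix.cons_val_one]
    rw [← Circle.coe_mul, ← AddCircle.toCircle_add, AddCircle.coe_add]
    congr 3 <;> rw [← AddCircle.coe_zsmul, zsmul_eq_mul]
  rw [h2] at h1
  have h3 : AddCircle.toCircle ((k 0 * α + k 1 * β : ℝ) : UnitAddCircle)
      = AddCircle.toCircle (0 : UnitAddCircle) := by
    rw [AddCircle.toCircle_zero]
    exact Circle.ext (by simpa using h1)
  have h4 := AddCircle.injective_toCircle one_ne_zero h3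
  obtain ⟨m, hm⟩ := (AddCircle.coe_eq_zero_iff (1 : ℝ)).1 h4
  have h5 := h (k 0) (k 1) (-m) (by push_cast; simp at hm; linarith)
  exact hk (by ext i; fin_cases i <;> simp [h5])

/-! ### Gluing permutations and the cocycle over the circle. -/

/-- The representative in `[0, 1)` of a point of the circle. -/
def rep (x : UnitAddCircle) : ℝ := AddCircle.equivIco 1 0 x

theorem rep_coe (r : ℝ) : rep (r : UnitAddCircle) = Int.fract r := by
  simp [rep, AddCircle.coe_equivIco_mk_apply]

theorem rep_nonneg (x : UnitAddCircle) : 0 ≤ rep x := (AddCircle.equivIco 1 0 x).2.1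

theorem rep_lt_one (x : UnitAddCircle) : rep x < 1 :=
  (AddCircle.equivIco (1 : ℝ) 0 x).2.2.trans_eq (zero_add _)

theorem coe_rep (x : UnitAddCircle) : (rep x : UnitAddCircle) = x :=
  (AddCircle.equivIco (1 : ℝ) 0).symm_apply_apply x

theorem rep_add_coe (x : UnitAddCircle) (t : ℝ) : rep (x + t) = Int.fract (rep x + t) := by
  rw [← rep_coe, AddCircle.coe_add, coe_rep]

theorem continuousAt_rep {x : UnitAddCircle} (hx : x ≠ 0) : ContinuousAt rep x :=
  continuousAt_subtype_val.comp (AddCircle.continuousAt_equivIco 1 0 (by simpa using hx))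

theorem measurable_rep : Measurable rep :=
  measurable_subtype_coe.comp (AddCircle.measurableEquivIco 1 0).measurable

/-- The gluing permutation of the cubes (`0` middle, `1` top, `2` right) across `x`-faces. -/
def glueX : Equiv.Perm (Fin 3) := Equiv.swap 0 2

/-- The gluing permutation of the cubes across `y`-faces. -/
def glueY : Equiv.Perm (Fin 3) := Equiv.swap 0 1

theorem glueX_mul_self : glueX * glueX = 1 := by decide

theorem glueX_pow (k : ℕ) : glueX ^ k = 1 ∨ glueX ^ k = glueX := by
  induction k with
  | zero => exact Or.inl (pow_zero _)
  | succ k ih =>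
    rcases ih with h | h
    · exact Or.inr (by rw [pow_succ, h, one_mul])
    · exact Or.inl (by rw [pow_succ, h, glueX_mul_self])

/-- Passing a singular edge on its two sides permutes the cubes differently, and the discrepancy,
a `3`-cycle, fixes no proper subset of the cubes. -/
theorem glue_discrepancy (k l : ℕ) {s : Finset (Fin 3)} (h : s.card = 1 ∨ s.card = 2) :
    (s.image (glueY * glueX ^ (k + 1))).image (glueY * glueX ^ l) ≠
      (s.image (glueY * glueX ^ k)).image (glueY * glueX ^ (l + 1)) := by
  -- The two composites differ by a conjugate of the commutator of `glueX` and `glueY`. As `glueX`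
  -- is an involution, only the parities of `k` and `l` matter, which leaves a finite check.
  rw [pow_succ, pow_succ]
  rcases glueX_pow k with hk | hk <;> rcases glueX_pow l with hl | hl <;> rw [hk, hl] <;>
    revert s <;> decide

/-- The permutation of the cubes along one return to the section `y ∈ ℤ` from a point with
`x`-coordinate `x`, when `x` increases by `α`. -/
def cocycle (α : ℝ) (x : UnitAddCircle) : Equiv.Perm (Fin 3) := glueY * glueX ^ ⌊rep x + α⌋₊

/-- The points of the circle that a translation by `δ` carries over `0`. -/
def crossing (δ : ℝ) : Set UnitAddCircle := {x | 1 - δ ≤ rep x}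

theorem measurableSet_crossing (δ : ℝ) : MeasurableSet (crossing δ) :=
  measurableSet_le measurable_const measurable_rep

theorem volume_crossing {δ : ℝ} (h1 : δ < 1) :
    volume (crossing δ) = ENNReal.ofReal δ := by
  have := (UnitAddCircle.measurePreserving_mk 0).measure_preimage
    (measurableSet_crossing δ).nullMeasurableSet
  rw [← this, Measure.restrict_apply
    ((UnitAddCircle.measurePreserving_mk 0).measurable (measurableSet_crossing δ))]
  have h2 : (QuotientAddGroup.mk ⁻¹' crossing δ ∩ Ioc (0 : ℝ) (0 + 1) : Set ℝ) = Ico (1 - δ) 1 := by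
    ext r
    simp only [crossing, mem_inter_iff, mem_preimage, mem_ofPred_eq, mem_Ioc, mem_Ico, rep_coe,
      zero_add]
    constructor
    · rintro ⟨h, h3, h4⟩
      rcases h4.lt_or_eq with h5 | rfl
      · rw [Int.fract_eq_self.2 ⟨h3.le, h5⟩] at h
        exact ⟨h, h5⟩
      · rw [Int.fract_one] at h; linarith
    · rintro ⟨h3, h4⟩
      rw [Int.fract_eq_self.2 ⟨by linarith, h4⟩]
      exact ⟨h3, by linarith, h4.le⟩
  rw [h2, Real.volume_Ico]
  congr 1; ring

/-- Two points of a half-open arc of length `δ` differ by less than `δ` modulo 1. -/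
theorem add_notMem_crossing {δ t : ℝ} (ht : ∀ k : ℤ, δ ≤ |t - k|) {x : UnitAddCircle}
    (hx : x ∈ crossing δ) : x + t ∉ crossing δ := by
  intro hx'
  simp only [crossing, mem_ofPred_eq, rep_add_coe] at hx hx'
  have h1 := Int.fract_lt_one (rep x + t)
  have h2 := rep_lt_one x
  have h3 := ht ⌊rep x + t⌋
  have h4 := Int.self_sub_floor (rep x + t)
  refine absurd h3 (not_le.2 (abs_lt.2 ⟨?_, ?_⟩)) <;> linarith

theorem rep_add_of_notMem {δ : ℝ} (h0 : 0 < δ) {x : UnitAddCircle} (hx : x ∉ crossing δ) :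
    rep (x + δ) = rep x + δ := by
  simp only [crossing, mem_ofPred_eq, not_le] at hx
  rw [rep_add_coe, Int.fract_eq_self]
  constructor <;> linarith [rep_nonneg x]

theorem rep_add_of_mem {δ : ℝ} (h1 : δ < 1) {x : UnitAddCircle} (hx : x ∈ crossing δ) :
    rep (x + δ) = rep x + δ - 1 := by
  simp only [crossing, mem_ofPred_eq] at hx
  rw [rep_add_coe, Int.fract_eq_iff]
  refine ⟨by linarith, by linarith [rep_lt_one x], 1, by push_cast; ring⟩

theorem rep_add_eq_sub_floor {α : ℝ} (hα : 0 < α) (x : UnitAddCircle) :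
    rep x + α = ⌊rep x + α⌋₊ + rep (x + α) := by
  have h : 0 ≤ rep x + α := by linarith [rep_nonneg x]
  rw [rep_add_coe, natCast_floor_eq_intCast_floor h, Int.floor_add_fract]

/-- If neither the starting point nor its translate by `α` is carried over 0, no x-face lies between
the two parallel paths, so both cross equally many. -/
theorem cocycle_add_eq {α δ : ℝ} (hα : 0 < α) (hδ : 0 < δ) {x : UnitAddCircle}
    (hx : x ∉ crossing δ) (hx' : x + α ∉ crossing δ) : cocycle α (x + δ) = cocycle α x := by
  have h1 := rep_add_of_notMem hδ hx
  have h2 := rep_add_eq_sub_floor hα x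
  have h3 := rep_nonneg (x + α)
  simp only [crossing, mem_ofPred_eq, not_le] at hx'
  rw [cocycle, cocycle, h1, (Nat.floor_eq_iff (by linarith [rep_nonneg x])).2
    (⟨by linarith, by linarith⟩ : ((⌊rep x + α⌋₊ : ℕ) : ℝ) ≤ rep x + δ + α ∧ _)]

/-- The permutations along two returns on the two sides of a singular edge. -/
theorem exists_cocycle_crossing {α δ : ℝ} (hα : 0 < α) (hδ : 0 < δ) (hδ1 : δ < 1)
    {x : UnitAddCircle} (hx : x ∉ crossing δ) (hx' : x + α ∈ crossing δ)
    (hx'' : x + α + α ∉ crossing δ) :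
    ∃ k l : ℕ, cocycle α x = glueY * glueX ^ k ∧ cocycle α (x + δ) = glueY * glueX ^ (k + 1) ∧
      cocycle α (x + α) = glueY * glueX ^ (l + 1) ∧
      cocycle α (x + δ + α) = glueY * glueX ^ l := by
  have h1 := rep_add_of_notMem hδ hx
  have h2 := rep_add_eq_sub_floor hα x
  have h3 := rep_lt_one (x + α)
  have h4 := rep_add_of_mem hδ1 hx'
  have h5 := rep_add_eq_sub_floor hα (x + α)
  have h6 := rep_nonneg (x + α + α)
  simp only [crossing, mem_ofPred_eq, not_le] at hx' hx''
  -- A point in the last arc of length `δ` that moves on by `α > 0` without ending in that arc must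
  -- wrap around; hence the subtraction in `l` below is not truncated.
  have h7 : 1 ≤ ⌊rep (x + α) + α⌋₊ := by
    by_contra h
    have : ⌊rep (x + α) + α⌋₊ = 0 := by omega
    rw [this] at h5
    push_cast at h5
    linarith
  refine ⟨⌊rep x + α⌋₊, ⌊rep (x + α) + α⌋₊ - 1, rfl, ?_, ?_, ?_⟩
  · rw [cocycle, h1, (Nat.floor_eq_iff (by linarith [rep_nonneg x])).2]
    push_cast
    constructor <;> linarith
  · rw [cocycle, Nat.sub_add_cancel h7]
  · rw [show x + (δ : UnitAddCircle) + α = x + α + δ by abel, cocycle, h4,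
      (Nat.floor_eq_iff (by linarith [rep_nonneg x])).2]
    rw [Nat.cast_sub h7]
    push_cast
    constructor <;> linarith

/-! ### Ergodicity of the first return map. -/

/-- If the first `n` translates of `C` avoid `C` and are contained in `N`, then `n` copies of `C`
fit into `N`. -/
theorem tower_measure_le {C N : Set (UnitAddTorus (Fin 2))} (hC : MeasurableSet C)
    (b : UnitAddTorus (Fin 2)) (n : ℕ)
    (hdisj : ∀ p ∈ C, ∀ j : ℕ, 1 ≤ j → j ≤ n → p + j • b ∉ C)
    (hsub : ∀ p ∈ C, ∀ j : ℕ, 1 ≤ j → j ≤ n → p + j • b ∈ N) :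
    n * volume C ≤ volume N := by
  have hm : ∀ j : ℕ, MeasurableSet ((fun q => q + -(j • b)) ⁻¹' C) := fun j =>
    (measurable_add_const _) hC
  have hpd : (Finset.Icc 1 n : Set ℕ).PairwiseDisjoint fun j => (fun q => q + -(j • b)) ⁻¹' C := by
    have key : ∀ i j : ℕ, 1 ≤ i → j ≤ n → i < j → ∀ q, q + -(i • b) ∈ C → q + -(j • b) ∉ C := by
      intro i j hi hj hij q hqi hqj
      refine hdisj _ hqj (j - i) (by omega) (by omega) ?_
      have : q + -(j • b) + (j - i) • b = q + -(i • b) := by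
        obtain ⟨m, rfl⟩ := Nat.exists_eq_add_of_lt hij
        rw [show i + m + 1 - i = m + 1 by omega, show i + m + 1 = i + (m + 1) by omega, add_nsmul]
        abel
      rwa [this]
    intro i hi j hj hij
    simp only [Finset.coe_Icc, mem_Icc] at hi hj
    refine Set.disjoint_left.2 fun q hqi hqj => ?_
    rcases lt_or_gt_of_ne hij with h | h
    · exact key i j hi.1 hj.2 h q hqi hqj
    · exact key j i hj.1 hi.2 h q hqj hqi
  calc (n : ENNReal) * volume C
      = ∑ j ∈ Finset.Icc 1 n, volume ((fun q => q + -(j • b)) ⁻¹' C) := by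
        simp [measure_preimage_add_right]
    _ = volume (⋃ j ∈ Finset.Icc 1 n, (fun q => q + -(j • b)) ⁻¹' C) :=
        (measure_biUnion_finset hpd fun j _ => hm j).symm
    _ ≤ volume N := by
        refine measure_mono fun q hq => ?_
        simp only [Finset.mem_Icc, mem_iUnion, mem_preimage] at hq
        obtain ⟨j, ⟨h1, h2⟩, hq⟩ := hq
        simpa using hsub _ hq j h1 h2

/-- The translation of the torus underlying the first return to the section `y ∈ ℤ`. -/
def shift (α β : ℝ) : UnitAddTorus (Fin 2) := ![(α : UnitAddCircle), (β : UnitAddCircle)]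

/-- The first return map to the section `y ∈ ℤ`, which consists of three tori. -/
def step (α β : ℝ) (e : UnitAddTorus (Fin 2) × Fin 3) : UnitAddTorus (Fin 2) × Fin 3 :=
  (e.1 + shift α β, cocycle α (e.1 0) e.2)

@[simp] theorem add_shift_zero (α β : ℝ) (p : UnitAddTorus (Fin 2)) :
    (p + shift α β) 0 = p 0 + α := rfl

@[simp] theorem add_shift_one (α β : ℝ) (p : UnitAddTorus (Fin 2)) :
    (p + shift α β) 1 = p 1 + β := rfl

/-- An equivariant family of proper subsets of the fibres varies a lot under small translations. -/
theorem le_measure_ne_translate {α β δ : ℝ} (hα : 0 < α) {n : ℕ} (hn : 1 ≤ n) (hδ : 0 < δ)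
    (hδ1 : δ < 1) (hsep : ∀ j : ℕ, 1 ≤ j → j ≤ n → ∀ k : ℤ, δ ≤ |j * α - k|)
    (a : UnitAddTorus (Fin 2) → Finset (Fin 3)) (hmeas : ∀ s, MeasurableSet {p | a p = s})
    (ha : ∀ p, a (p + shift α β) = (a p).image (cocycle α (p 0)))
    (hcard : ∀ᵐ p, (a p).card = 1 ∨ (a p).card = 2) :
    n * ENNReal.ofReal δ ≤ 2 * volume {p | a (p + shift δ 0) ≠ a p} := by
  set σ := shift α β with hσ
  set N : Set (UnitAddTorus (Fin 2)) := {p | a (p + shift δ 0) ≠ a p} with hN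
  have hNm : MeasurableSet N := by
    have : N = ⋃ s, {p | a p = s} ∩ ((fun p => p + shift δ 0) ⁻¹' {p | a p = s})ᶜ := by
      ext p; simp [hN, eq_comm]
    rw [this]
    exact MeasurableSet.iUnion fun s => (hmeas s).inter (measurable_add_const _ (hmeas s)).compl
  set W : Set (UnitAddTorus (Fin 2)) :=
    {p | (a p).card = 1 ∨ (a p).card = 2} ∩ {p | p 0 ∈ crossing δ} with hW
  have hWm : MeasurableSet W := by
    refine MeasurableSet.inter ?_ (measurable_pi_apply 0 (measurableSet_crossing δ))
    have : {p | (a p).card = 1 ∨ (a p).card = 2}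
        = ⋃ s ∈ {s : Finset (Fin 3) | s.card = 1 ∨ s.card = 2}, {p | a p = s} := by
      ext p; simp
    rw [this]
    exact MeasurableSet.biUnion (Set.to_countable _) fun s _ => hmeas s
  have hWvol : volume W = ENNReal.ofReal δ := by
    have hWae : W =ᵐ[volume] {p : UnitAddTorus (Fin 2) | p 0 ∈ crossing δ} := by
      filter_upwards [hcard] with p hp
      exact propext (and_iff_right hp)
    rw [measure_congr hWae, ← volume_crossing hδ1]
    exact (measurePreserving_eval (fun _ : Fin 2 => (volume : Measure UnitAddCircle))
      0).measure_preimage (measurableSet_crossing δ).nullMeasurableSet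
  have hsepneg : ∀ j : ℕ, 1 ≤ j → j ≤ n → ∀ k : ℤ, δ ≤ |(-(j * α : ℝ)) - k| := by
    intro j h1 h2 k
    have := hsep j h1 h2 (-k)
    rwa [← abs_neg, Int.cast_neg, neg_sub, sub_eq_add_neg, add_comm, ← sub_eq_add_neg] at this
  have hfwd : ∀ p : UnitAddTorus (Fin 2), p 0 ∈ crossing δ → ∀ j : ℕ, 1 ≤ j → j ≤ n →
      (p + j • σ) 0 ∉ crossing δ := by
    intro p hp j h1 h2
    have := add_notMem_crossing (hsep j h1 h2) hp
    simpa [hσ, shift, nsmul_eq_mul] using this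
  have hbwd : ∀ p : UnitAddTorus (Fin 2), p 0 ∈ crossing δ → ∀ j : ℕ, 1 ≤ j → j ≤ n →
      (p + j • (-σ)) 0 ∉ crossing δ := by
    intro p hp j h1 h2
    have := add_notMem_crossing (hsepneg j h1 h2) hp
    simpa [hσ, shift, nsmul_eq_mul] using this
  have hcomm : ∀ p : UnitAddTorus (Fin 2), p + σ + shift δ 0 = p + shift δ 0 + σ := fun p => by abel
  -- Away from crossings both fibres are moved by the same permutation, so agreement and
  -- disagreement propagate in both directions.
  have hinv : ∀ p : UnitAddTorus (Fin 2), p 0 ∉ crossing δ → (p + σ) 0 ∉ crossing δ →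
      (p + σ ∈ N ↔ p ∈ N) := by
    intro p h1 h2
    have hc := cocycle_add_eq hα hδ h1 h2
    simp only [hN, mem_ofPred_eq, hcomm, ha, add_shift_zero, hc]
    exact (Finset.image_injective (Equiv.injective _)).ne_iff
  -- Agreement at both `p - σ` and `p + σ` would equate the two images of one proper subset along
  -- the two sides of the singular edge.
  have hcross : ∀ p ∈ W, p + -σ ∈ N ∨ p + σ ∈ N := by
    rintro p ⟨hpc, hp⟩
    by_contra! h
    obtain ⟨q, rfl⟩ : ∃ q, p = q + σ := ⟨p - σ, by abel⟩
    have h1 := hbwd _ hp 1 le_rfl hn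
    have h2 := hfwd _ hp 1 le_rfl hn
    rw [one_nsmul, add_neg_cancel_right] at h1
    rw [one_nsmul] at h2
    rw [add_neg_cancel_right] at h
    obtain ⟨k, l, e1, e2, e3, e4⟩ := exists_cocycle_crossing hα hδ hδ1 h1 hp h2
    have hq : a (q + shift δ 0) = a q := by simpa [hN] using h.1
    have hq2 : a (q + σ + σ + shift δ 0) = a (q + σ + σ) := by simpa [hN] using h.2
    rw [hcomm, hcomm, ha, ha, ha, ha, hq] at hq2
    simp only [add_shift_zero, hσ] at hq2
    rw [e1, e2, e3, e4] at hq2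
    have hqc : (a q).card = 1 ∨ (a q).card = 2 := by
      rwa [mem_ofPred_eq, ha, Finset.card_image_of_injective _ (Equiv.injective _)] at hpc
    exact glue_discrepancy k l hqc hq2
  -- Disagreement before the edge is followed backwards and disagreement after it forwards; each
  -- gives a tower of height `n` inside `N`, whence the factor 2.
  set C₁ := W ∩ (fun p => p + -σ) ⁻¹' N with hC₁
  set C₂ := W ∩ (fun p => p + σ) ⁻¹' N with hC₂
  have hsub₁ : ∀ p ∈ C₁, ∀ j : ℕ, 1 ≤ j → j ≤ n → p + j • (-σ) ∈ N := by
    rintro p ⟨hpW, hpN⟩ j hj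
    induction j, hj using Nat.le_induction with
    | base => intro _; simpa using hpN
    | succ j hj ih =>
      intro hjn
      have hstep : p + (j + 1) • (-σ) + σ = p + j • (-σ) := by
        rw [add_nsmul, one_nsmul]; abel
      rw [← hinv _ (hbwd p hpW.2 _ (by omega) hjn), hstep]
      · exact ih (by omega)
      · rw [hstep]
        exact hbwd p hpW.2 _ hj (by omega)
  have hsub₂ : ∀ p ∈ C₂, ∀ j : ℕ, 1 ≤ j → j ≤ n → p + j • σ ∈ N := by
    rintro p ⟨hpW, hpN⟩ j hj
    induction j, hj using Nat.le_induction with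
    | base => intro _; simpa using hpN
    | succ j hj ih =>
      intro hjn
      have hstep : p + (j + 1) • σ = p + j • σ + σ := by
        rw [add_nsmul, one_nsmul]; abel
      rw [hstep, hinv _ (hfwd p hpW.2 _ hj (by omega))]
      · exact ih (by omega)
      · rw [← hstep]
        exact hfwd p hpW.2 _ (by omega) hjn
  have h₁ : n * volume C₁ ≤ volume N :=
    tower_measure_le (hWm.inter (measurable_add_const _ hNm)) (-σ) n
      (fun p hp j h1 h2 h3 => hbwd p hp.1.2 j h1 h2 h3.1.2) hsub₁
  have h₂ : n * volume C₂ ≤ volume N :=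
    tower_measure_le (hWm.inter (measurable_add_const _ hNm)) σ n
      (fun p hp j h1 h2 h3 => hfwd p hp.1.2 j h1 h2 h3.1.2) hsub₂
  calc n * ENNReal.ofReal δ = n * volume W := by rw [hWvol]
    _ ≤ n * (volume C₁ + volume C₂) := by
        gcongr
        refine (measure_mono fun p hp => ?_).trans (measure_union_le _ _)
        rcases hcross p hp with h | h
        · exact Or.inl ⟨hp, h⟩
        · exact Or.inr ⟨hp, h⟩
    _ ≤ volume N + volume N := by rw [mul_add]; exact add_le_add h₁ h₂
    _ = 2 * volume N := (two_mul _).symm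

/-- Where `a` changes, the point lies in the symmetric difference of a level set and its translate.
There are finitely many level sets, and translation is continuous in measure. -/
theorem tendsto_measure_ne_translate (a : UnitAddTorus (Fin 2) → Finset (Fin 3))
    (hmeas : ∀ s, MeasurableSet {p | a p = s}) :
    Tendsto (fun δ : ℝ => volume {p | a (p + shift δ 0) ≠ a p}) (𝓝 0) (𝓝 0) := by
  have hc : Continuous fun q : ℝ × UnitAddTorus (Fin 2) => q.2 + shift q.1 0 := by
    unfold shift
    refine continuous_snd.add (continuous_pi fun i => ?_)
    fin_cases i
    · exact (AddCircle.continuous_mk' 1).comp continuous_fst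
    · exact continuous_const
  let F : C(ℝ, C(UnitAddTorus (Fin 2), UnitAddTorus (Fin 2))) := ContinuousMap.curry ⟨_, hc⟩
  have hmp : ∀ δ, MeasurePreserving (F δ) volume volume := fun δ =>
    measurePreserving_add_right volume (shift δ 0)
  have hle : ∀ δ : ℝ, volume {p | a (p + shift δ 0) ≠ a p}
      ≤ ∑ s : Finset (Fin 3), volume (symmDiff (F δ ⁻¹' {p | a p = s}) (F 0 ⁻¹' {p | a p = s})) := by
    intro δ
    refine (measure_mono fun p hp => ?_).trans (measure_iUnion_fintype_le _ _)
    have h0 : F 0 p = p := by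
      change p + shift 0 0 = p
      rw [add_eq_left]
      ext i; fin_cases i <;> simp [shift]
    refine mem_iUnion.2 ⟨a p, Or.inr ⟨?_, hp⟩⟩
    simp [h0]
  refine tendsto_of_tendsto_of_tendsto_of_le_of_le tendsto_const_nhds ?_ (fun _ => zero_le) hle
  have hsum : Tendsto (fun δ : ℝ => ∑ s : Finset (Fin 3),
      volume (symmDiff (F δ ⁻¹' {p | a p = s}) (F 0 ⁻¹' {p | a p = s}))) (𝓝 0)
      (𝓝 (∑ _s : Finset (Fin 3), 0)) := tendsto_finsetSum _ fun s _ =>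
    tendsto_measure_symmDiff_preimage_nhds_zero (F.continuous.tendsto 0)
    (Eventually.of_forall hmp) (hmp 0) (hmeas s).nullMeasurableSet (measure_ne_top _ _)
  rwa [Finset.sum_const_zero] at hsum

/-- Normalized counting measure on the three cubes. -/
def fiberMeasure : Measure (Fin 3) := (3 : ENNReal)⁻¹ • Measure.count

instance isProbabilityMeasure_fiberMeasure : IsProbabilityMeasure fiberMeasure :=
  ⟨by simp [fiberMeasure, ENNReal.inv_mul_cancel]⟩

/-- The normalized Lebesgue measure on the section. -/
def sectionMeasure : Measure (UnitAddTorus (Fin 2) × Fin 3) := volume.prod fiberMeasure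

instance isProbabilityMeasure_sectionMeasure : IsProbabilityMeasure sectionMeasure := by
  unfold sectionMeasure; infer_instance

theorem measurable_cocycle (α : ℝ) :
    Measurable fun e : UnitAddTorus (Fin 2) × Fin 3 => cocycle α (e.1 0) e.2 := by
  have : Measurable fun e : UnitAddTorus (Fin 2) × Fin 3 => (⌊rep (e.1 0) + α⌋₊, e.2) :=
    (Nat.measurable_floor.comp ((measurable_rep.comp
      ((measurable_pi_apply 0).comp measurable_fst)).add_const α)).prodMk measurable_snd
  exact (measurable_of_countable fun q : ℕ × Fin 3 => (glueY * glueX ^ q.1) q.2).comp this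

theorem measurable_step (α β : ℝ) : Measurable (step α β) :=
  (measurable_fst.add_const _).prodMk (measurable_cocycle α)

theorem measurePreserving_step (α β : ℝ) :
    MeasurePreserving (step α β) sectionMeasure sectionMeasure := by
  refine (measurePreserving_add_right volume (shift α β)).skew_product
    (g := fun p i => cocycle α (p 0) i) (measurable_cocycle α) (ae_of_all _ fun p => ?_)
  simp only [fiberMeasure, Measure.map_smul]
  congr 1
  ext s hs
  rw [Measure.map_apply (measurable_of_countable _) hs, ← Equiv.image_symm_eq_preimage,
    Measure.count_injective_image (Equiv.injective _)]

/-- The first return map is ergodic. -/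
theorem ergodic_step {α β : ℝ} (hα : 0 < α) (hα' : Irrational α)
    (ha : ∀ k : Fin 2 → ℤ, k ≠ 0 → UnitAddTorus.mFourier k (shift α β) ≠ 1) :
    Ergodic (step α β) sectionMeasure := by
  refine ⟨measurePreserving_step α β, ⟨fun A hA hinv => ?_⟩⟩
  classical
  set a : UnitAddTorus (Fin 2) → Finset (Fin 3) := fun p => {i | (p, i) ∈ A} with hadef
  have hmem : ∀ p i, i ∈ a p ↔ (p, i) ∈ A := fun p i => by simp [hadef]
  have hAi : ∀ i, MeasurableSet {p | (p, i) ∈ A} := fun i => measurable_prodMk_right hA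
  have hmeas : ∀ s, MeasurableSet {p | a p = s} := by
    intro s
    have : {p | a p = s} = ⋂ i, {p | (p, i) ∈ A ↔ i ∈ s} := by
      ext p; simp [Finset.ext_iff, hmem]
    rw [this]
    refine MeasurableSet.iInter fun i => ?_
    by_cases h : i ∈ s
    · simpa [h] using hAi i
    · simp only [h, iff_false]; exact (hAi i).compl
  have hequiv : ∀ p, a (p + shift α β) = (a p).image (cocycle α (p 0)) := by
    intro p
    ext i
    rw [hmem, Finset.mem_image]
    have h1 : ∀ j, (p, j) ∈ A ↔ (p + shift α β, cocycle α (p 0) j) ∈ A :=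
      fun j => (Set.ext_iff.1 hinv (p, j)).symm
    constructor
    · intro h
      refine ⟨(cocycle α (p 0)).symm i, ?_, by simp⟩
      rw [hmem, h1]
      simpa using h
    · rintro ⟨j, hj, rfl⟩
      rwa [← h1, ← hmem]
  have hcardinv : ∀ k, (fun p => p + shift α β) ⁻¹' {p | (a p).card = k} = {p | (a p).card = k} := by
    intro k
    ext p
    simp only [mem_preimage, mem_ofPred_eq, hequiv,
      Finset.card_image_of_injective _ (Equiv.injective _)]
  have hcardmeas : ∀ k, MeasurableSet {p | (a p).card = k} := by
    intro k
    have : {p | (a p).card = k} = ⋃ s ∈ {s : Finset (Fin 3) | s.card = k}, {p | a p = s} := by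
      ext p; simp
    rw [this]
    exact MeasurableSet.biUnion (Set.to_countable _) fun s _ => hmeas s
  have hR := ergodic_add_right_torus ha
  -- By ergodicity each level set of the invariant function `card` is null or conull, and countably
  -- many null sets cannot cover the torus.
  have hconst : ∃ k, ∀ᵐ p, (a p).card = k := by
    by_contra h
    rw [not_exists] at h
    have h0 : ∀ k, ∀ᵐ p, (a p).card ≠ k := by
      intro k
      have := hR.toPreErgodic.ae_mem_or_ae_notMem (hcardmeas k) (hcardinv k)
      exact this.resolve_left (h k)
    obtain ⟨p, hp⟩ := (ae_all_iff.2 h0).exists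
    exact hp _ rfl
  obtain ⟨k, hk⟩ := hconst
  have hk3 : k ≤ 3 := by
    obtain ⟨p, hp⟩ := hk.exists
    rw [← hp]
    exact (Finset.card_le_univ _).trans_eq (by simp)
  have hlift : ∀ {P : UnitAddTorus (Fin 2) → Prop}, (∀ᵐ p, P p) → ∀ᵐ e ∂sectionMeasure, P e.1 :=
    fun h => (Measure.quasiMeasurePreserving_fst (μ := volume) (ν := fiberMeasure)).ae h
  rw [eventuallyConst_set]
  have hproper : ¬ (k = 1 ∨ k = 2) := by
    intro hk12
    have hT := tendsto_measure_ne_translate a hmeas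
    rw [ENNReal.tendsto_nhds_zero] at hT
    -- The threshold 1/16 makes the upper bound 2 · 1/16 = 1/8 smaller than the lower bound 1/4 for
    -- `n * δ`.
    obtain ⟨ε, hε, hε'⟩ := Metric.eventually_nhds_iff.1 (hT (1 / 16) (by simp))
    obtain ⟨n, δ, hn, hδ, hδε, hnδ, hsep⟩ := exists_separated_multiples hα' (lt_min hε one_pos)
    have h1 := le_measure_ne_translate hα hn hδ (hδε.trans_le (min_le_right _ _)) hsep a hmeas
      hequiv (by filter_upwards [hk] with p hp; rwa [hp])
    have h2 := hε' (y := δ) (by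
      rw [Real.dist_eq, sub_zero, abs_of_pos hδ]; exact hδε.trans_le (min_le_left _ _))
    have h3 : (n : ENNReal) * ENNReal.ofReal δ ≤ 2 * (1 / 16) := h1.trans (by gcongr)
    rw [← ENNReal.ofReal_natCast, ← ENNReal.ofReal_mul (Nat.cast_nonneg n)] at h3
    have h4 : ENNReal.ofReal (1 / 4) ≤ 2 * (1 / 16) := (ENNReal.ofReal_le_ofReal hnδ).trans h3
    have h5 : (2 * (1 / 16) : ENNReal) = ENNReal.ofReal (1 / 8) := by
      rw [show (1 / 8 : ℝ) = 2 * (1 / 16) by norm_num, ENNReal.ofReal_mul (by norm_num),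
        ENNReal.ofReal_div_of_pos (by norm_num)]
      simp
    rw [h5, ENNReal.ofReal_le_ofReal_iff (by norm_num)] at h4
    norm_num at h4
  obtain rfl | rfl : k = 0 ∨ k = 3 := by omega
  · right
    filter_upwards [hlift hk] with e he
    rw [Finset.card_eq_zero] at he
    have := hmem e.1 e.2
    rw [he] at this
    simpa using this
  · left
    filter_upwards [hlift hk] with e he
    have h6 : a e.1 = Finset.univ := Finset.eq_univ_of_card _ (by simpa using he)
    have := hmem e.1 e.2
    rw [h6] at this
    simpa using this

/-! ### Equidistribution of every orbit of the first return map. -/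

/-- Weak convergence of measures extends to bounded functions that are continuous off a closed
null set. -/
theorem tendsto_integral_of_continuousAt_off {ι Ω : Type*} [MeasurableSpace Ω]
    [TopologicalSpace Ω] [TopologicalSpace.PseudoMetrizableSpace Ω] [BorelSpace Ω] {L : Filter ι} {u : ι → ProbabilityMeasure Ω}
    {ν : ProbabilityMeasure Ω} (h : Tendsto u L (𝓝 ν)) {G : Ω → ℝ} (hGm : Measurable G) {C : ℝ}
    (hC : ∀ e, |G e| ≤ C) {D : Set Ω} (hD : IsClosed D) (hνD : (ν : Measure Ω) D = 0)
    (hG : ∀ e, e ∉ D → ContinuousAt G e) :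
    Tendsto (fun i => ∫ e, G e ∂(u i : Measure Ω)) L (𝓝 (∫ e, G e ∂(ν : Measure Ω))) := by
  let := TopologicalSpace.pseudoMetrizableSpacePseudoMetric Ω
  rw [ProbabilityMeasure.tendsto_iff_forall_integral_tendsto] at h
  have hC0 : 0 ≤ C := by
    obtain ⟨e⟩ := ProbabilityMeasure.nonempty ν
    exact (abs_nonneg _).trans (hC e)
  rw [Metric.tendsto_nhds]
  intro ε hε
  have hlim := tendsto_integral_thickenedIndicator_of_isClosed (ν : Measure Ω) hD
    (δs := fun n : ℕ => (1 : ℝ) / (n + 1)) (fun n => Nat.one_div_pos_of_nat)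
    tendsto_one_div_add_atTop_nhds_zero_nat
  rw [measureReal_def, hνD, ENNReal.toReal_zero] at hlim
  -- `C + 1` avoids division by 0. The two cutoff errors and the weak convergence error are each at
  -- most ε/4.
  set η := ε / (4 * (C + 1)) with hη
  have hηpos : 0 < η := by positivity
  have hCη : C * η ≤ ε / 4 := by
    rw [hη, mul_div_assoc', div_le_div_iff₀ (by positivity) (by norm_num)]
    nlinarith
  obtain ⟨n, hn⟩ := (hlim.eventually (gt_mem_nhds hηpos)).exists
  let χ : BoundedContinuousFunction Ω ℝ := BoundedContinuousFunction.ofNormedAddCommGroup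
    (fun e => (thickenedIndicator (Nat.one_div_pos_of_nat (α := ℝ) (n := n)) D e : ℝ))
    (by fun_prop) 1 (fun e => by
      simpa using thickenedIndicator_le_one (Nat.one_div_pos_of_nat (α := ℝ) (n := n)) D e)
  have hχ0 : ∀ e, 0 ≤ χ e := fun e => NNReal.coe_nonneg _
  have hχ1 : ∀ e, χ e ≤ 1 := fun e => by
    exact NNReal.coe_le_one.2
      (thickenedIndicator_le_one (Nat.one_div_pos_of_nat (α := ℝ) (n := n)) D e)
  have hχD : ∀ e ∈ D, χ e = 1 := fun e he => by
    have := thickenedIndicator_one (Nat.one_div_pos_of_nat (α := ℝ) (n := n)) D he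
    exact congrArg NNReal.toReal this
  have hle : ∀ e, |G e * (1 - χ e)| ≤ C * (1 - χ e) := fun e => by
    rw [abs_mul, abs_of_nonneg (sub_nonneg.2 (hχ1 e))]
    exact mul_le_mul_of_nonneg_right (hC e) (sub_nonneg.2 (hχ1 e))
  -- On `D` the factor `1 - χ` vanishes and squeezes the bounded `G` to 0; off `D`, `G` itself is
  -- continuous.
  have hcont : Continuous fun e => G e * (1 - χ e) := by
    refine continuous_iff_continuousAt.2 fun e => ?_
    by_cases he : e ∈ D
    · have h1 : Tendsto (fun e' => C * (1 - χ e')) (𝓝 e) (𝓝 0) := by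
        have : Continuous fun e' => C * (1 - χ e') := by fun_prop
        simpa [hχD e he] using this.tendsto e
      have h2 := squeeze_zero_norm (f := fun e' => G e' * (1 - χ e')) hle h1
      simpa [ContinuousAt, hχD e he] using h2
    · exact (hG e he).mul (by fun_prop)
  let g : BoundedContinuousFunction Ω ℝ := BoundedContinuousFunction.ofNormedAddCommGroup
    (fun e => G e * (1 - χ e)) hcont C (fun e => (hle e).trans (by nlinarith [hχ0 e]))
  have hGint : ∀ ρ : ProbabilityMeasure Ω, Integrable G (ρ : Measure Ω) := fun ρ =>
    Integrable.of_bound hGm.aestronglyMeasurable C (ae_of_all _ hC)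
  have hdiff : ∀ ρ : ProbabilityMeasure Ω,
      |∫ e, G e ∂(ρ : Measure Ω) - ∫ e, g e ∂(ρ : Measure Ω)| ≤ C * ∫ e, χ e ∂(ρ : Measure Ω) := by
    intro ρ
    rw [← integral_sub (hGint ρ) (g.integrable _), ← integral_const_mul]
    refine (norm_integral_le_integral_norm _).trans
      (integral_mono ((hGint ρ).sub (g.integrable _)).norm ((χ.integrable _).const_mul C)
        fun e => ?_)
    change |G e - G e * (1 - χ e)| ≤ C * χ e
    rw [show G e - G e * (1 - χ e) = G e * χ e by ring, abs_mul, abs_of_nonneg (hχ0 e)]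
    exact mul_le_mul_of_nonneg_right (hC e) (hχ0 e)
  filter_upwards [(h χ).eventually (gt_mem_nhds hn),
    (Metric.tendsto_nhds.1 (h g)) (ε / 4) (by positivity)] with i hi hi'
  have h1 := abs_le.1 (hdiff (u i))
  have h2 := abs_le.1 (hdiff ν)
  have h3 := abs_lt.1 hi'
  have h4 : C * ∫ e, χ e ∂(u i : Measure Ω) ≤ ε / 4 :=
    (mul_le_mul_of_nonneg_left hi.le hC0).trans hCη
  have h5 : C * ∫ e, χ e ∂(ν : Measure Ω) ≤ ε / 4 :=
    (mul_le_mul_of_nonneg_left hn.le hC0).trans hCη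
  rw [Real.dist_eq, abs_lt]
  constructor <;> linarith

/-- A point of the circle can be translated into `crossing δ` for every small `δ`, so it is null. -/
theorem volume_coord_eq (k : Fin 2) (c : UnitAddCircle) :
    volume {p : UnitAddTorus (Fin 2) | p k = c} = 0 := by
  have h0 : (volume : Measure UnitAddCircle) {c} = 0 := by
    refine le_antisymm (ENNReal.le_of_forall_pos_le_add fun ε hε _ => ?_) zero_le
    set δ : ℝ := min ε (1 / 2) with hδdef
    have hδ : 0 < δ := lt_min hε (by norm_num)
    have hδ1 : δ < 1 := (min_le_right _ _).trans_lt (by norm_num)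
    have hsub : ({c} : Set UnitAddCircle) ⊆ (fun x => x + (-c + (-δ : ℝ))) ⁻¹' crossing δ := by
      rintro _ rfl
      have : Int.fract (-δ) = 1 - δ := by
        rw [Int.fract_eq_iff]
        exact ⟨by linarith, by linarith, -1, by push_cast; ring⟩
      simp only [mem_preimage, crossing, mem_ofPred_eq, add_neg_cancel_left, rep_coe, this, le_refl]
    refine (measure_mono hsub).trans ?_
    rw [measure_preimage_add_right, volume_crossing hδ1, zero_add]
    exact ENNReal.ofReal_le_of_le_toReal ((min_le_left (ε : ℝ) (1 / 2)).trans_eq (by simp))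
  rw [← h0]
  exact (measurePreserving_eval (fun _ : Fin 2 => (volume : Measure UnitAddCircle))
    k).measure_preimage (measurableSet_singleton c).nullMeasurableSet

theorem coord_isClosed (k : Fin 2) (c : UnitAddCircle) :
    IsClosed {e : UnitAddTorus (Fin 2) × Fin 3 | e.1 k = c} :=
  isClosed_eq ((continuous_apply k).comp continuous_fst) continuous_const

theorem sectionMeasure_coord_eq (k : Fin 2) (c : UnitAddCircle) :
    sectionMeasure {e | e.1 k = c} = 0 :=
  (Measure.quasiMeasurePreserving_fst (μ := volume) (ν := fiberMeasure)).preimage_null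
    (volume_coord_eq k c)

theorem eventually_floor_rep {x : UnitAddCircle} {t : ℝ} (hx : x ≠ 0) (ht : 0 ≤ t)
    (hxt : x + t ≠ 0) : ∀ᶠ y in 𝓝 x, ⌊rep y + t⌋₊ = ⌊rep x + t⌋₊ := by
  have hnn : 0 ≤ rep x + t := add_nonneg (rep_nonneg x) ht
  have hne : (⌊rep x + t⌋₊ : ℝ) ≠ rep x + t := by
    intro h
    apply hxt
    rw [← coe_rep x, ← AddCircle.coe_add, ← h]
    exact (AddCircle.coe_eq_zero_iff (1 : ℝ)).2 ⟨⌊rep x + t⌋₊, by simp⟩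
  have hc : ContinuousAt (fun y => rep y + t) x := (continuousAt_rep hx).add continuousAt_const
  filter_upwards [hc.eventually (lt_mem_nhds (lt_of_le_of_ne (Nat.floor_le hnn) hne)),
    hc.eventually (gt_mem_nhds (Nat.lt_floor_add_one (rep x + t)))] with y h1 h2
  rw [Nat.floor_eq_iff (add_nonneg (rep_nonneg y) ht)]
  exact ⟨h1.le, h2⟩

theorem continuousAt_step {α β : ℝ} (hα : 0 < α) {e : UnitAddTorus (Fin 2) × Fin 3}
    (h0 : e.1 0 ≠ 0) (h1 : e.1 0 ≠ -α) : ContinuousAt (step α β) e := by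
  have hc : ContinuousAt (fun e : UnitAddTorus (Fin 2) × Fin 3 => e.1 0) e :=
    ((continuous_apply 0).comp continuous_fst).continuousAt
  have hev := hc.eventually (eventually_floor_rep h0 hα.le (t := α)
    (fun h => h1 (eq_neg_of_add_eq_zero_left h)))
  have hcont : Continuous fun e' : UnitAddTorus (Fin 2) × Fin 3 =>
      (e'.1 + shift α β, cocycle α (e.1 0) e'.2) :=
    (continuous_fst.add continuous_const).prodMk (continuous_of_discreteTopology.comp continuous_snd)
  refine hcont.continuousAt.congr ?_
  filter_upwards [hev] with e' he'
  simp only [step, cocycle, he']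

/-- The empirical measure of the first `N + 1` points of the orbit of `e`. -/
def empirical (α β : ℝ) (e : UnitAddTorus (Fin 2) × Fin 3) (N : ℕ) :
    ProbabilityMeasure (UnitAddTorus (Fin 2) × Fin 3) :=
  ⟨((N + 1 : ℕ) : ENNReal)⁻¹ • ∑ n ∈ Finset.range (N + 1), Measure.dirac ((step α β)^[n] e),
    ⟨by
      simp only [Measure.smul_apply, Measure.finsetSum_apply, measure_univ, Finset.sum_const,
        Finset.card_range, smul_eq_mul, nsmul_eq_mul, mul_one]
      exact ENNReal.inv_mul_cancel (by simp) (ENNReal.natCast_ne_top _)⟩⟩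

theorem integral_empirical (α β : ℝ) (e : UnitAddTorus (Fin 2) × Fin 3) (N : ℕ)
    (G : UnitAddTorus (Fin 2) × Fin 3 → ℝ) :
    ∫ x, G x ∂(empirical α β e N : Measure (UnitAddTorus (Fin 2) × Fin 3)) =
      (1 / ((N + 1 : ℕ) : ℝ)) * ∑ n ∈ Finset.range (N + 1), G ((step α β)^[n] e) := by
  change ∫ x, G x ∂(((N + 1 : ℕ) : ENNReal)⁻¹ •
    ∑ n ∈ Finset.range (N + 1), Measure.dirac ((step α β)^[n] e)) = _
  rw [integral_smul_measure, integral_finsetSum_measure fun n _ => integrable_dirac (by finiteness)]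
  simp only [integral_dirac, ENNReal.toReal_inv, ENNReal.toReal_natCast, smul_eq_mul, one_div]

/-- The difference of the two sums telescopes to its two end terms. -/
theorem tendsto_empirical_comp_step_sub (α β : ℝ) (e : UnitAddTorus (Fin 2) × Fin 3)
    {G : UnitAddTorus (Fin 2) × Fin 3 → ℝ} {C : ℝ} (hC : ∀ e, |G e| ≤ C) :
    Tendsto (fun N => ∫ x, G (step α β x) ∂(empirical α β e N : Measure _) -
      ∫ x, G x ∂(empirical α β e N : Measure _)) atTop (𝓝 0) := by
  have hlim : Tendsto (fun N : ℕ => (2 * C) * (1 / ((N : ℝ) + 1))) atTop (𝓝 0) := by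
    simpa using tendsto_one_div_add_atTop_nhds_zero_nat.const_mul (2 * C)
  refine squeeze_zero_norm (fun N => ?_) hlim
  rw [integral_empirical, integral_empirical, ← mul_sub, ← Finset.sum_sub_distrib]
  simp only [← Function.iterate_succ_apply']
  have hpos : (0 : ℝ) ≤ 1 / ((N : ℝ) + 1) := by positivity
  rw [Finset.sum_range_sub fun n => G ((step α β)^[n] e), Real.norm_eq_abs, abs_mul, mul_comm]
  push_cast
  rw [abs_of_nonneg hpos]
  refine mul_le_mul_of_nonneg_right ((abs_sub _ _).trans ?_) hpos
  linarith [hC ((step α β)^[N + 1] e), hC ((step α β)^[0] e)]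

/-- By compactness it suffices to identify every limit along an ultrafilter. The torus marginal is
identified before invariance, since invariance under the discontinuous `step` requires its
discontinuity set to be null. -/
theorem tendsto_empirical {α β : ℝ} (hα : 0 < α) (hα' : Irrational α)
    (ha : ∀ k : Fin 2 → ℤ, k ≠ 0 → UnitAddTorus.mFourier k (shift α β) ≠ 1)
    (e : UnitAddTorus (Fin 2) × Fin 3) :
    Tendsto (empirical α β e) atTop (𝓝 ⟨sectionMeasure, inferInstance⟩) := by
  rw [tendsto_iff_ultrafilter]
  intro U hU
  obtain ⟨ν, -, hν⟩ := isCompact_univ.ultrafilter_le_nhds' (U.map (empirical α β e)) univ_mem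
  have hconv : Tendsto (empirical α β e) U (𝓝 ν) := hν
  suffices hνμ : (ν : Measure (UnitAddTorus (Fin 2) × Fin 3)) = sectionMeasure by
    have : ν = ⟨sectionMeasure, inferInstance⟩ := Subtype.ext hνμ
    rwa [← this]
  have hcont : ∀ G : BoundedContinuousFunction (UnitAddTorus (Fin 2) × Fin 3) ℝ,
      Tendsto (fun N => ∫ x, G x ∂(empirical α β e N : Measure _)) U (𝓝 (∫ x, G x ∂(ν : Measure (UnitAddTorus (Fin 2) × Fin 3)))) :=
    ProbabilityMeasure.tendsto_iff_forall_integral_tendsto.1 hconv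
  have hstep : ∀ G : BoundedContinuousFunction (UnitAddTorus (Fin 2) × Fin 3) ℝ,
      Tendsto (fun N => ∫ x, G (step α β x) ∂(empirical α β e N : Measure _)) U
        (𝓝 (∫ x, G x ∂(ν : Measure (UnitAddTorus (Fin 2) × Fin 3)))) := by
    intro G
    have h1 := (tendsto_empirical_comp_step_sub α β e (G := G) (C := ‖G‖)
      (fun x => G.norm_coe_le_norm x)).mono_left hU
    simpa using h1.add (hcont G)
  have hmarg : (ν : Measure (UnitAddTorus (Fin 2) × Fin 3)).map Prod.fst =
      (volume : Measure (UnitAddTorus (Fin 2))) := by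
    have hprob : IsProbabilityMeasure ((ν : Measure (UnitAddTorus (Fin 2) × Fin 3)).map Prod.fst) :=
      Measure.isProbabilityMeasure_map measurable_fst.aemeasurable
    refine eq_volume_of_invariant ha _ ⟨measurable_add_const _, ?_⟩
    have := Measure.isProbabilityMeasure_map (μ := (ν : Measure (UnitAddTorus (Fin 2) × Fin 3)).map
      Prod.fst) (measurable_add_const (shift α β)).aemeasurable
    refine ext_of_forall_integral_eq_of_IsFiniteMeasure fun g => ?_
    rw [integral_map (measurable_add_const _).aemeasurable
      g.continuous.measurable.aestronglyMeasurable,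
      integral_map (f := fun x => g (x + shift α β)) measurable_fst.aemeasurable
        (g.continuous.comp (continuous_add_const _)).measurable.aestronglyMeasurable,
      integral_map measurable_fst.aemeasurable g.continuous.measurable.aestronglyMeasurable]
    -- The torus component of `step` is continuous, so this part needs no control of
    -- discontinuities.
    let G : BoundedContinuousFunction (UnitAddTorus (Fin 2) × Fin 3) ℝ :=
      g.compContinuous ⟨Prod.fst, continuous_fst⟩
    let G' : BoundedContinuousFunction (UnitAddTorus (Fin 2) × Fin 3) ℝ :=
      g.compContinuous ⟨fun e => e.1 + shift α β, by fun_prop⟩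
    exact tendsto_nhds_unique (hcont G') (hstep G)
  have hlift : ∀ {P : UnitAddTorus (Fin 2) → Prop}, (∀ᵐ p, P p) →
      ∀ᵐ e ∂(ν : Measure (UnitAddTorus (Fin 2) × Fin 3)), P e.1 := by
    intro P hP
    rw [← hmarg] at hP
    exact ae_of_ae_map measurable_fst.aemeasurable hP
  have hinv : MeasurePreserving (step α β) (ν : Measure (UnitAddTorus (Fin 2) × Fin 3)) ν := by
    refine ⟨measurable_step α β, ?_⟩
    have := Measure.isProbabilityMeasure_map (μ := (ν : Measure (UnitAddTorus (Fin 2) × Fin 3)))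
      (measurable_step α β).aemeasurable
    refine ext_of_forall_integral_eq_of_IsFiniteMeasure fun g => ?_
    rw [integral_map (measurable_step α β).aemeasurable
      g.continuous.measurable.aestronglyMeasurable]
    refine tendsto_nhds_unique (tendsto_integral_of_continuousAt_off hconv
      (g.continuous.measurable.comp (measurable_step α β)) (C := ‖g‖)
      (fun x => g.norm_coe_le_norm _)
      ((coord_isClosed 0 0).union (coord_isClosed 0 (-α))) ?_ fun x hx => ?_) (hstep g)
    · have h0 : ∀ c, (ν : Measure (UnitAddTorus (Fin 2) × Fin 3)) {e | e.1 0 = c} = 0 := by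
        intro c
        have := hlift (measure_eq_zero_iff_ae_notMem.1 (volume_coord_eq 0 c))
        exact measure_eq_zero_iff_ae_notMem.2 this
      exact measure_union_null (h0 _) (h0 _)
    · simp only [mem_union, mem_ofPred_eq, not_or] at hx
      exact g.continuous.continuousAt.comp (continuousAt_step hα hx.1 hx.2)
  -- Every point of the finite fibre has positive mass, so a null set has empty fibres over almost
  -- every point of the torus, and the marginal of `ν` is Lebesgue measure.
  have hac : (ν : Measure (UnitAddTorus (Fin 2) × Fin 3)) ≪ sectionMeasure := by
    refine Measure.AbsolutelyContinuous.mk fun s hs h0 => ?_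
    rw [sectionMeasure, Measure.measure_prod_null hs] at h0
    rw [measure_eq_zero_iff_ae_notMem]
    filter_upwards [hlift h0] with e he hes
    have h1 : fiberMeasure (Prod.mk e.1 ⁻¹' s) = 0 := he
    rw [fiberMeasure, Measure.smul_apply, smul_eq_mul, mul_eq_zero, Measure.count_eq_zero_iff] at h1
    rcases h1 with h1 | h1
    · simp at h1
    · have : e.2 ∈ Prod.mk e.1 ⁻¹' s := hes
      rw [h1] at this
      exact this
  exact (ergodic_step hα hα' ha).eq_of_absolutelyContinuous hinv hac

/-! ### The three cubes and invariants of the face identifications. -/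

/-- The corners of the three cubes. -/
def corner : Fin 3 → Fin 3 → ℝ := ![![0, 0, 0], ![0, 1, 0], ![1, 0, 0]]

theorem mem_unitCube {w : Fin 3 → ℝ} : w ∈ Icc (0 : Fin 3 → ℝ) 1 ↔ ∀ k, 0 ≤ w k ∧ w k ≤ 1 := by
  simp only [mem_Icc, Pi.le_def, ← forall_and, Pi.zero_apply, Pi.one_apply]

theorem mem_unitCube_vec {a b c : ℝ} : ![a, b, c] ∈ Icc (0 : Fin 3 → ℝ) 1 ↔
    (0 ≤ a ∧ a ≤ 1) ∧ (0 ≤ b ∧ b ≤ 1) ∧ (0 ≤ c ∧ c ≤ 1) := by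
  rw [mem_unitCube]; simp [Fin.forall_fin_succ]

theorem mem_solid_iff {q : Fin 3 → ℝ} :
    q ∈ solid ↔ ∃ i, q - corner i ∈ Icc (0 : Fin 3 → ℝ) 1 := by
  simp only [solid, mem_union, mem_Icc, Pi.le_def, Fin.forall_fin_succ, Fin.exists_fin_succ, corner]
  simp
  norm_num [sub_nonneg, sub_le_iff_le_add, or_assoc]

theorem add_corner_mem {w : Fin 3 → ℝ} (hw : w ∈ Icc (0 : Fin 3 → ℝ) 1) (i : Fin 3) :
    w + corner i ∈ solid :=
  mem_solid_iff.2 ⟨i, by rwa [add_sub_cancel_right]⟩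

/-- The projection, extended by a junk value outside the solid. -/
def projExt (q : Fin 3 → ℝ) : Manifold :=
  open Classical in if h : q ∈ solid then proj ⟨q, h⟩ else
    proj ⟨0 + corner 0, add_corner_mem (by simp) 0⟩

theorem projExt_of_mem {q : Fin 3 → ℝ} (h : q ∈ solid) : projExt q = proj ⟨q, h⟩ := dif_pos h

theorem projExt_eq_of_rel {p q : Fin 3 → ℝ} (hp : p ∈ solid) (hq : q ∈ solid)
    (h : FaceRel ⟨p, hp⟩ ⟨q, hq⟩) : projExt q = projExt p := by
  rw [projExt_of_mem hp, projExt_of_mem hq]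
  exact (Quot.sound h).symm

/-- A label of the open cube, of the open face between cubes, or of the singular edge on which the
point of the solid with the given first two coordinates lies. -/
def faceKey (x y : ℝ) : ℕ :=
  open Classical in
  if x = 0 ∨ x = 1 ∨ x = 2 then
    if y = 0 ∨ y = 1 ∨ y = 2 then 0 else if 1 < y then 1 else if x = 1 then 2 else 3
  else if y = 0 ∨ y = 1 ∨ y = 2 then if 1 < x then 4 else if y = 1 then 5 else 6
  else if 1 < y then 7 else if 1 < x then 8 else 9

/-- Invariants of a point of the solid under the face identifications. -/
def invariants (p : solid) : ℕ × (Fin 3 → UnitAddCircle) :=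
  (faceKey (p.1 0) (p.1 1), fun k => (p.1 k : UnitAddCircle))

theorem solid_bounds {q : Fin 3 → ℝ} (hq : q ∈ solid) :
    0 ≤ q 0 ∧ 0 ≤ q 1 ∧ q 0 ≤ 2 ∧ q 1 ≤ 2 ∧ (q 0 ≤ 1 ∨ q 1 ≤ 1) := by
  simp only [solid, mem_union, mem_Icc, Pi.le_def, Fin.forall_fin_succ] at hq
  simp at hq
  grind

theorem coe_two_eq_zero : ((2 : ℝ) : UnitAddCircle) = 0 :=
  (AddCircle.coe_eq_zero_iff (1 : ℝ)).2 ⟨2, by norm_num⟩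

theorem coe_one_eq_zero : ((1 : ℝ) : UnitAddCircle) = 0 :=
  (AddCircle.coe_eq_zero_iff (1 : ℝ)).2 ⟨1, by norm_num⟩

/-- Equality in the quotient means a chain of identifications; a function constant on each
identification is the means of showing that two points remain distinct. -/
theorem invariants_eq_of_rel (p q : solid) (h : FaceRel p q) : invariants p = invariants q := by
  have hp := solid_bounds p.2
  have hq' := solid_bounds q.2
  obtain ⟨hp, hy, hq⟩ | ⟨hp, hy, hq⟩ | ⟨hp, hx, hq⟩ | ⟨hp, hx, hq⟩ | ⟨hp, hq⟩ := h <;>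
    rw [hq] at hq' <;> unfold invariants <;> rw [hq] <;>
    refine Prod.ext ?_ (funext fun k => ?_)
  · simp [faceKey, hp] at *; grind
  · fin_cases k <;> simp [hp, coe_one_eq_zero]
  · simp [faceKey, hp] at *
  · fin_cases k <;> simp [hp, coe_two_eq_zero]
  · simp [faceKey, hp] at *
  · fin_cases k <;> simp [hp, coe_two_eq_zero]
  · simp [faceKey, hp] at *; grind
  · fin_cases k <;> simp [hp, coe_one_eq_zero]
  · rfl
  · fin_cases k <;> simp [hp, coe_one_eq_zero]

theorem invariants_eq_of_proj_eq {p q : solid} (h : proj p = proj q) :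
    invariants p = invariants q :=
  congrArg (Quot.lift invariants invariants_eq_of_rel) h

/-- Away from the singular edges the label distinguishes the three cubes at a given relative
position, even on their faces. -/
theorem faceKey_corner_injective {a b : ℝ} (ha : 0 ≤ a ∧ a ≤ 1) (hb : 0 ≤ b ∧ b ≤ 1)
    (hab : ¬ ((a = 0 ∨ a = 1) ∧ (b = 0 ∨ b = 1))) {i j : Fin 3}
    (h : faceKey (a + corner i 0) (b + corner i 1) = faceKey (a + corner j 0) (b + corner j 1)) :
    i = j := by
  fin_cases i <;> fin_cases j <;> simp [faceKey, corner] at * <;> grind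

theorem projExt_mem_singular {w : Fin 3 → ℝ} (hw : w ∈ Icc (0 : Fin 3 → ℝ) 1) (i : Fin 3)
    (h0 : w 0 = 0 ∨ w 0 = 1) (h1 : w 1 = 0 ∨ w 1 = 1) : projExt (w + corner i) ∈ singular := by
  refine ⟨⟨_, add_corner_mem hw i⟩, (projExt_of_mem _).symm, ?_, ?_⟩
  · have : ∃ m : ℤ, corner i 0 = m := by
      fin_cases i
      exacts [⟨0, by simp [corner]⟩, ⟨0, by simp [corner]⟩, ⟨1, by simp [corner]⟩]
    obtain ⟨m, hm⟩ := this
    rcases h0 with h | h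
    · exact ⟨m, by simp [h, hm]⟩
    · exact ⟨1 + m, by simp [h, hm]⟩
  · have : ∃ m : ℤ, corner i 1 = m := by
      fin_cases i
      exacts [⟨0, by simp [corner]⟩, ⟨1, by simp [corner]⟩, ⟨0, by simp [corner]⟩]
    obtain ⟨m, hm⟩ := this
    rcases h1 with h | h
    · exact ⟨m, by simp [h, hm]⟩
    · exact ⟨1 + m, by simp [h, hm]⟩

/-- A nonsingular point has only one description from which one can move on in direction `v`. -/
theorem eq_of_projExt_eq {v w w' : Fin 3 → ℝ} (hv : ∀ k, v k ≠ 0) {i j : Fin 3} {ε : ℝ} (hε : 0 < ε)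
    (hw : w ∈ Icc (0 : Fin 3 → ℝ) 1) (hw' : w' ∈ Icc (0 : Fin 3 → ℝ) 1)
    (hwε : w + ε • v ∈ Icc (0 : Fin 3 → ℝ) 1) (hwε' : w' + ε • v ∈ Icc (0 : Fin 3 → ℝ) 1)
    (h : projExt (w + corner i) = projExt (w' + corner j))
    (hs : projExt (w + corner i) ∉ singular) : w = w' ∧ i = j := by
  rw [projExt_of_mem (add_corner_mem hw i), projExt_of_mem (add_corner_mem hw' j)] at h
  have hinv := invariants_eq_of_proj_eq h
  simp only [invariants, Prod.mk.injEq] at hinv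
  have hww : w = w' := by
    ext k
    have h1 := congrFun hinv.2 k
    have hci : ∀ i, ((corner i k : ℝ) : UnitAddCircle) = 0 := by
      intro i
      fin_cases i <;> fin_cases k <;> simp [corner, coe_one_eq_zero]
    simp only [Pi.add_apply, AddCircle.coe_add, hci, add_zero] at h1
    rw [← sub_eq_zero, ← AddCircle.coe_sub, AddCircle.coe_eq_zero_iff] at h1
    obtain ⟨m, hm⟩ := h1
    rw [zsmul_eq_mul, mul_one] at hm
    have b1 := mem_unitCube.1 hw k
    have b2 := mem_unitCube.1 hw' k
    have b3 := mem_unitCube.1 hwε k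
    have b4 := mem_unitCube.1 hwε' k
    simp only [Pi.add_apply, Pi.smul_apply, smul_eq_mul] at b3 b4
    have hne : ε * v k ≠ 0 := mul_ne_zero hε.ne' (hv k)
    have hm1 : (-1 : ℝ) ≤ m := by linarith
    have hm2 : (m : ℝ) ≤ 1 := by linarith
    have hm1' : -1 ≤ m := by exact_mod_cast hm1
    have hm2' : m ≤ 1 := by exact_mod_cast hm2
    obtain rfl | rfl | rfl : m = -1 ∨ m = 0 ∨ m = 1 := by omega
    -- Here `w` and `w'` lie on opposite faces in coordinate `k`; moving by the same `ε * v k` keeps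
    -- both in the cube only if it is zero.
    · exact absurd (le_antisymm (by push_cast at hm; linarith) (by push_cast at hm; linarith)) hne
    · push_cast at hm; linarith
    · exact absurd (le_antisymm (by push_cast at hm; linarith) (by push_cast at hm; linarith)) hne
  subst hww
  exact ⟨rfl, faceKey_corner_injective (mem_unitCube.1 hw 0) (mem_unitCube.1 hw 1)
    (fun h => hs (projExt_mem_singular hw i h.1 h.2)) hinv.1⟩

/-- A segment in the solid starts inside one of the cubes. -/
theorem exists_corner_of_segment {q v : Fin 3 → ℝ} {b : ℝ} (hb : 0 < b)
    (h : ∀ s ∈ Icc 0 b, q + s • v ∈ solid) :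
    ∃ (i : Fin 3) (ε : ℝ), 0 < ε ∧ ε ≤ b ∧ q - corner i ∈ Icc (0 : Fin 3 → ℝ) 1 ∧
      q - corner i + ε • v ∈ Icc (0 : Fin 3 → ℝ) 1 := by
  have hex : ∃ᶠ s in 𝓝[>] (0 : ℝ), ∃ i, q + s • v - corner i ∈ Icc (0 : Fin 3 → ℝ) 1 := by
    refine Eventually.frequently ?_
    filter_upwards [Ioc_mem_nhdsGT hb] with s hs
    exact mem_solid_iff.1 (h s ⟨hs.1.le, hs.2⟩)
  -- Pigeonhole: one cube contains points of the segment at times accumulating at 0. Being closed,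
  -- it also contains the starting point.
  have hex' : ∃ i, ∃ᶠ s in 𝓝[>] (0 : ℝ), q + s • v - corner i ∈ Icc (0 : Fin 3 → ℝ) 1 := by
    by_contra! hcon
    have := eventually_all.2 hcon
    exact hex (this.mono fun s hs => by simpa using hs)
  obtain ⟨i, hi⟩ := hex'
  have hc : Continuous fun s : ℝ => q + s • v - corner i := by fun_prop
  refine ⟨i, ?_⟩
  have h0 : q - corner i ∈ Icc (0 : Fin 3 → ℝ) 1 := by
    have hcl : IsClosed ((fun s : ℝ => q + s • v - corner i) ⁻¹' Icc (0 : Fin 3 → ℝ) 1) :=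
      isClosed_Icc.preimage hc
    have := hcl.mem_of_frequently_of_tendsto (b := 𝓝[>] (0 : ℝ)) (f := id) hi
      (tendsto_id.mono_left nhdsWithin_le_nhds)
    simpa using this
  obtain ⟨ε, hε, hε'⟩ := (hi.and_eventually (Ioc_mem_nhdsGT hb)).exists
  exact ⟨ε, hε'.1, hε'.2, h0, by rwa [sub_add_eq_add_sub]⟩

theorem add_smul_mem_unitCube {w v : Fin 3 → ℝ} {s S : ℝ} (hs : 0 ≤ s) (hsS : s ≤ S)
    (hw : w ∈ Icc (0 : Fin 3 → ℝ) 1) (hwS : w + S • v ∈ Icc (0 : Fin 3 → ℝ) 1) :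
    w + s • v ∈ Icc (0 : Fin 3 → ℝ) 1 := by
  rw [mem_unitCube] at *
  intro k
  have h1 := hw k
  have h2 := hwS k
  simp only [Pi.add_apply, Pi.smul_apply, smul_eq_mul] at *
  rcases le_total 0 (v k) with hv | hv
  · constructor <;> nlinarith [mul_nonneg hs hv, mul_le_mul_of_nonneg_right hsS hv]
  · constructor <;> nlinarith [mul_nonneg hs (neg_nonneg.2 hv),
      mul_le_mul_of_nonneg_right hsS (neg_nonneg.2 hv)]

/-! ### Uniqueness of the continuation of a nonsingular geodesic. -/

variable {v : Fin 3 → ℝ} {γ : ℝ → Manifold}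

theorem follow_right (hv : ∀ k, v k ≠ 0) (hγ : IsHalfInfiniteGeodesic v γ)
    (hsing : ∀ t, 0 ≤ t → γ t ∉ singular) {t S : ℝ} (ht : 0 ≤ t) (hS : 0 < S) {w : Fin 3 → ℝ}
    {i : Fin 3} (hw : w ∈ Icc (0 : Fin 3 → ℝ) 1) (hwS : w + S • v ∈ Icc (0 : Fin 3 → ℝ) 1)
    (h : γ t = projExt (w + corner i)) :
    ∃ ε, 0 < ε ∧ ∀ s, 0 ≤ s → s ≤ ε → γ (t + s) = projExt (w + s • v + corner i) := by
  obtain ⟨b, hb, q, hq⟩ := hγ.1 t ht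
  have hseg : ∀ s ∈ Icc 0 (b - t), q + s • v ∈ solid := by
    intro s hs
    obtain ⟨h1, -⟩ := hq (t + s) ⟨by linarith [hs.1], by linarith [hs.2]⟩
    rwa [add_sub_cancel_left] at h1
  obtain ⟨j, ε, hε, hεb, hj, hjε⟩ := exists_corner_of_segment (sub_pos.2 hb) hseg
  have hq0 : γ t = projExt (q - corner j + corner j) := by
    obtain ⟨h1, h2⟩ := hq t ⟨le_rfl, hb.le⟩
    rw [h2, ← projExt_of_mem]
    congr 1
    simp
  obtain ⟨e1, rfl⟩ := eq_of_projExt_eq hv (lt_min hε hS) hw hj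
    (add_smul_mem_unitCube (lt_min hε hS).le (min_le_right _ _) hw hwS)
    (add_smul_mem_unitCube (lt_min hε hS).le (min_le_left _ _) hj hjε)
    (h.symm.trans hq0) (h ▸ hsing t ht)
  refine ⟨ε, hε, fun s hs hsε => ?_⟩
  obtain ⟨h1, h2⟩ := hq (t + s) ⟨by linarith, by linarith⟩
  rw [h2, ← projExt_of_mem, e1]
  congr 1
  rw [add_sub_cancel_left]
  abel

/-- The segment given by the geodesic before time `t + S` is traced backwards and matched with the
known path at the earlier time `t + S - ε`; the match carries over to the endpoint. -/
theorem follow_left (hv : ∀ k, v k ≠ 0) (hγ : IsHalfInfiniteGeodesic v γ)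
    (hsing : ∀ t, 0 ≤ t → γ t ∉ singular) {t S : ℝ} (ht : 0 ≤ t) (hS : 0 < S) {w : Fin 3 → ℝ}
    {i : Fin 3} (hw : w ∈ Icc (0 : Fin 3 → ℝ) 1) (hwS : w + S • v ∈ Icc (0 : Fin 3 → ℝ) 1)
    (h : ∀ s, 0 ≤ s → s < S → γ (t + s) = projExt (w + s • v + corner i)) :
    γ (t + S) = projExt (w + S • v + corner i) := by
  obtain ⟨a, ha0, ha, q, hq⟩ := hγ.2 (t + S) (by linarith)
  set Q := q + (t + S - a) • v with hQ
  have hback : ∀ s : ℝ, q + (t + S - s - a) • v = Q + s • (-v) := by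
    intro s
    rw [hQ, smul_neg, show t + S - s - a = (t + S - a) - s by ring, sub_smul]
    abel
  have hb : 0 < min (t + S - a) S := lt_min (by linarith) hS
  have hseg : ∀ s ∈ Icc 0 (min (t + S - a) S), Q + s • (-v) ∈ solid := by
    intro s hs
    have := hs.2.trans (min_le_left _ _)
    obtain ⟨h1, -⟩ := hq (t + S - s) ⟨by linarith, by linarith [hs.1]⟩
    rwa [hback] at h1
  obtain ⟨j, ε, hε, hεb, hj, hjε⟩ := exists_corner_of_segment hb hseg
  have hε1 := hεb.trans (min_le_left _ _)
  have hε2 := hεb.trans (min_le_right _ _)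
  have hγε : γ (t + (S - ε)) = projExt (Q - corner j + ε • (-v) + corner j) := by
    obtain ⟨h1, h2⟩ := hq (t + (S - ε)) ⟨by linarith, by linarith⟩
    rw [h2, ← projExt_of_mem, show t + (S - ε) - a = t + S - ε - a by ring, hback]
    congr 1
    abel
  have hh := h (S - ε) (by linarith) (by linarith)
  have hend : w + (S - ε) • v + ε • v = w + S • v := by rw [sub_smul]; abel
  have hend' : Q - corner j + ε • (-v) + ε • v = Q - corner j := by rw [smul_neg]; abel
  obtain ⟨e1, rfl⟩ := eq_of_projExt_eq hv hε
    (add_smul_mem_unitCube (by linarith) (by linarith) hw hwS) hjε (by rwa [hend]) (by rwa [hend'])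
    (hh.symm.trans hγε) (hh ▸ hsing _ (by linarith))
  obtain ⟨h1, h2⟩ := hq (t + S) ⟨ha.le, le_rfl⟩
  rw [h2, ← projExt_of_mem, ← hend, e1, hend', sub_add_cancel]

/-- A geodesic follows a segment inside a cube. -/
theorem follow_segment (hv : ∀ k, v k ≠ 0) (hγ : IsHalfInfiniteGeodesic v γ)
    (hsing : ∀ t, 0 ≤ t → γ t ∉ singular) {t S : ℝ} (ht : 0 ≤ t) (hS : 0 ≤ S) {w : Fin 3 → ℝ}
    {i : Fin 3} (hw : w ∈ Icc (0 : Fin 3 → ℝ) 1) (hwS : w + S • v ∈ Icc (0 : Fin 3 → ℝ) 1)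
    (h : γ t = projExt (w + corner i)) : γ (t + S) = projExt (w + S • v + corner i) := by
  set P : ℝ → Prop := fun s => γ (t + s) = projExt (w + s • v + corner i) with hP
  -- Continuity argument on the supremum of `A`: `follow_left` shows that it is attained, and
  -- `follow_right` that it can be exceeded while it is less than `S`.
  set A : Set ℝ := {s | s ∈ Icc 0 S ∧ ∀ s' ∈ Icc 0 s, P s'} with hA
  have hP0 : P 0 := by simpa [hP] using h
  have h0A : (0 : ℝ) ∈ A := by
    refine ⟨⟨le_rfl, hS⟩, fun s hs => ?_⟩
    rwa [le_antisymm hs.2 hs.1]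
  have hbdd : BddAbove A := ⟨S, fun s hs => hs.1.2⟩
  set m := sSup A with hm
  have hm0 : 0 ≤ m := le_csSup hbdd h0A
  have hmS : m ≤ S := csSup_le ⟨0, h0A⟩ fun s hs => hs.1.2
  have hlt : ∀ s, 0 ≤ s → s < m → P s := by
    intro s hs hsm
    obtain ⟨s', hs', hss'⟩ := exists_lt_of_lt_csSup ⟨0, h0A⟩ hsm
    exact hs'.2 s ⟨hs, hss'.le⟩
  have hPm : P m := by
    rcases hm0.eq_or_lt with hm' | hm'
    · rwa [← hm']
    · exact follow_left hv hγ hsing ht hm' hw (add_smul_mem_unitCube hm0 hmS hw hwS) hlt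
  rcases hmS.eq_or_lt with hmS' | hmS'
  · rwa [hmS'] at hPm
  · exfalso
    have hsub : w + m • v + (S - m) • v = w + S • v := by rw [sub_smul]; abel
    obtain ⟨ε, hε, hε'⟩ := follow_right hv hγ hsing (t := t + m) (by linarith) (sub_pos.2 hmS')
      (add_smul_mem_unitCube hm0 hmS hw hwS) (by rwa [hsub]) hPm
    have hmem : m + min ε (S - m) ∈ A := by
      have hmin : 0 < min ε (S - m) := lt_min hε (sub_pos.2 hmS')
      refine ⟨⟨by linarith, by linarith [min_le_right ε (S - m)]⟩, fun s hs => ?_⟩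
      rcases lt_or_ge s m with hsm | hsm
      · exact hlt s hs.1 hsm
      · have := hε' (s - m) (by linarith) (by linarith [hs.2, min_le_left ε (S - m)])
        rw [show t + m + (s - m) = t + s by ring,
          show w + m • v + (s - m) • v = w + s • v by rw [sub_smul]; abel] at this
        exact this
    have := le_csSup hbdd hmem
    linarith [lt_min hε (sub_pos.2 hmS')]

/-! ### Adapted coordinates and reduction to the first return map. -/

/-- Coordinates in the unit cube adapted to the direction `v`, in which motion in direction `v` is
increasing. -/
def flip (v w : Fin 3 → ℝ) : Fin 3 → ℝ := fun k => if 0 < v k then w k else 1 - w k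

theorem flip_flip (v w : Fin 3 → ℝ) : flip v (flip v w) = w := by
  ext k; simp only [flip]; split_ifs <;> ring

theorem flip_mem {v w : Fin 3 → ℝ} (hw : w ∈ Icc (0 : Fin 3 → ℝ) 1) :
    flip v w ∈ Icc (0 : Fin 3 → ℝ) 1 := by
  rw [mem_unitCube] at *
  intro k
  have := hw k
  simp only [flip]
  split_ifs <;> constructor <;> linarith

theorem flip_add (v w : Fin 3 → ℝ) (s : ℝ) :
    flip v (w + s • |v|) = flip v w + s • v := by
  ext k
  simp only [flip, Pi.add_apply, Pi.smul_apply, Pi.abs_apply, smul_eq_mul]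
  split_ifs with h
  · rw [abs_of_pos h]
  · rw [abs_of_nonpos (not_lt.1 h)]; ring

/-- The point of the `i`-th cube with adapted coordinates `w`. -/
def cubePoint (v w : Fin 3 → ℝ) (i : Fin 3) : Manifold := projExt (flip v w + corner i)

theorem glueX_glueX (i : Fin 3) : glueX (glueX i) = i := by revert i; decide

theorem glueY_glueY (i : Fin 3) : glueY (glueY i) = i := by revert i; decide

theorem projExt_glueX {b c : ℝ} (hb : 0 ≤ b ∧ b ≤ 1) (hc : 0 ≤ c ∧ c ≤ 1) (i : Fin 3) :
    projExt (![1, b, c] + corner i) = projExt (![0, b, c] + corner (glueX i)) := by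
  have h1 : ![1, b, c] ∈ Icc (0 : Fin 3 → ℝ) 1 := mem_unitCube_vec.2 ⟨by norm_num, hb, hc⟩
  have h0 : ![0, b, c] ∈ Icc (0 : Fin 3 → ℝ) 1 := mem_unitCube_vec.2 ⟨by norm_num, hb, hc⟩
  fin_cases i
  · congr 1
    ext k; fin_cases k <;> simp [corner, glueX]
  · refine projExt_eq_of_rel (add_corner_mem h0 _) (add_corner_mem h1 _) (.xTop _ _ ?_ ?_ ?_)
    · simp [corner, glueX, Equiv.swap_apply_def]
    · simp [corner, glueX, Equiv.swap_apply_def, hb.1]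
    · ext k; fin_cases k <;> simp [corner, glueX, Equiv.swap_apply_def]
  · refine projExt_eq_of_rel (add_corner_mem h0 _) (add_corner_mem h1 _) (.xBottom _ _ ?_ ?_ ?_)
    · simp [corner, glueX]
    · simp [corner, glueX, hb.2]
    · ext k; fin_cases k <;> simp [corner, glueX]; norm_num

theorem projExt_glueY {a c : ℝ} (ha : 0 ≤ a ∧ a ≤ 1) (hc : 0 ≤ c ∧ c ≤ 1) (i : Fin 3) :
    projExt (![a, 1, c] + corner i) = projExt (![a, 0, c] + corner (glueY i)) := by
  have h1 : ![a, 1, c] ∈ Icc (0 : Fin 3 → ℝ) 1 := mem_unitCube_vec.2 ⟨ha, by norm_num, hc⟩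
  have h0 : ![a, 0, c] ∈ Icc (0 : Fin 3 → ℝ) 1 := mem_unitCube_vec.2 ⟨ha, by norm_num, hc⟩
  fin_cases i
  · congr 1
    ext k; fin_cases k <;> simp [corner, glueY]
  · refine projExt_eq_of_rel (add_corner_mem h0 _) (add_corner_mem h1 _) (.yLeft _ _ ?_ ?_ ?_)
    · simp [corner, glueY]
    · simp [corner, glueY, ha.2]
    · ext k; fin_cases k <;> simp [corner, glueY]; norm_num
  · refine projExt_eq_of_rel (add_corner_mem h0 _) (add_corner_mem h1 _) (.yRight _ _ ?_ ?_ ?_)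
    · simp [corner, glueY, Equiv.swap_apply_def]
    · simp [corner, glueY, Equiv.swap_apply_def, ha.1]
    · ext k; fin_cases k <;> simp [corner, glueY, Equiv.swap_apply_def]

theorem projExt_glueZ {a b : ℝ} (ha : 0 ≤ a ∧ a ≤ 1) (hb : 0 ≤ b ∧ b ≤ 1) (i : Fin 3) :
    projExt (![a, b, 1] + corner i) = projExt (![a, b, 0] + corner i) := by
  have h1 : ![a, b, 1] ∈ Icc (0 : Fin 3 → ℝ) 1 := mem_unitCube_vec.2 ⟨ha, hb, by norm_num⟩
  have h0 : ![a, b, 0] ∈ Icc (0 : Fin 3 → ℝ) 1 := mem_unitCube_vec.2 ⟨ha, hb, by norm_num⟩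
  have hc : corner i 2 = 0 := by fin_cases i <;> simp [corner]
  refine projExt_eq_of_rel (add_corner_mem h0 _) (add_corner_mem h1 _) (.z _ _ ?_ ?_)
  · simp [hc]
  · ext k; fin_cases k <;> simp [hc]

/-- The reflection of the unit interval adapted to the sign of `r`. -/
def reflect (r a : ℝ) : ℝ := if 0 < r then a else 1 - a

theorem reflect_mem {r a : ℝ} (ha : 0 ≤ a ∧ a ≤ 1) : 0 ≤ reflect r a ∧ reflect r a ≤ 1 := by
  unfold reflect; split_ifs <;> constructor <;> linarith

theorem flip_vec (v : Fin 3 → ℝ) (a b c : ℝ) :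
    flip v ![a, b, c] = ![reflect (v 0) a, reflect (v 1) b, reflect (v 2) c] := by
  ext k; fin_cases k <;> rfl

/-- When `v 0` is not positive, the reflection exchanges the two faces and the inverse gluing
appears; `glueX` is an involution, so the rule is the same for both signs. -/
theorem cubePoint_glueX (v : Fin 3 → ℝ) {b c : ℝ} (hb : 0 ≤ b ∧ b ≤ 1) (hc : 0 ≤ c ∧ c ≤ 1)
    (i : Fin 3) : cubePoint v ![1, b, c] i = cubePoint v ![0, b, c] (glueX i) := by
  have h := projExt_glueX (reflect_mem (r := v 1) hb) (reflect_mem (r := v 2) hc)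
  simp only [cubePoint, flip_vec, reflect.eq_1 (v 0)]
  split_ifs
  · exact h i
  · rw [sub_self, sub_zero, h, glueX_glueX]

theorem cubePoint_glueY (v : Fin 3 → ℝ) {a c : ℝ} (ha : 0 ≤ a ∧ a ≤ 1) (hc : 0 ≤ c ∧ c ≤ 1)
    (i : Fin 3) : cubePoint v ![a, 1, c] i = cubePoint v ![a, 0, c] (glueY i) := by
  have h := projExt_glueY (reflect_mem (r := v 0) ha) (reflect_mem (r := v 2) hc)
  simp only [cubePoint, flip_vec, reflect.eq_1 (v 1)]
  split_ifs
  · exact h i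
  · rw [sub_self, sub_zero, h, glueY_glueY]

theorem cubePoint_glueZ (v : Fin 3 → ℝ) {a b : ℝ} (ha : 0 ≤ a ∧ a ≤ 1) (hb : 0 ≤ b ∧ b ≤ 1)
    (i : Fin 3) : cubePoint v ![a, b, 1] i = cubePoint v ![a, b, 0] i := by
  have h := projExt_glueZ (reflect_mem (r := v 0) ha) (reflect_mem (r := v 1) hb)
  simp only [cubePoint, flip_vec, reflect.eq_1 (v 2)]
  split_ifs
  · exact h i
  · rw [sub_self, sub_zero, h]

theorem exists_cubePoint (v : Fin 3 → ℝ) (m : Manifold) :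
    ∃ a b c i, (0 ≤ a ∧ a ≤ 1) ∧ (0 ≤ b ∧ b ≤ 1) ∧ (0 ≤ c ∧ c ≤ 1) ∧
      m = cubePoint v ![a, b, c] i := by
  obtain ⟨p, rfl⟩ := Quot.exists_rep m
  obtain ⟨i, hi⟩ := mem_solid_iff.1 p.2
  have hw := mem_unitCube.1 (flip_mem (v := v) hi)
  refine ⟨_, _, _, i, hw 0, hw 1, hw 2, ?_⟩
  have : ![flip v (p.1 - corner i) 0, flip v (p.1 - corner i) 1, flip v (p.1 - corner i) 2]
      = flip v (p.1 - corner i) := by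
    ext k; fin_cases k <;> rfl
  rw [this, cubePoint, flip_flip, sub_add_cancel, projExt_of_mem p.2]
  rfl

theorem follow_in_cube (hv : ∀ k, v k ≠ 0) (hγ : IsHalfInfiniteGeodesic v γ)
    (hsing : ∀ t, 0 ≤ t → γ t ∉ singular) {t S : ℝ} (ht : 0 ≤ t) (hS : 0 ≤ S) {a b c : ℝ}
    {i : Fin 3} (ha : 0 ≤ a) (hb : 0 ≤ b) (hc : 0 ≤ c) (ha' : a + S * |v 0| ≤ 1)
    (hb' : b + S * |v 1| ≤ 1) (hc' : c + S * |v 2| ≤ 1) (h : γ t = cubePoint v ![a, b, c] i) :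
    γ (t + S) = cubePoint v ![a + S * |v 0|, b + S * |v 1|, c + S * |v 2|] i := by
  have hsum : ![a + S * |v 0|, b + S * |v 1|, c + S * |v 2|] = ![a, b, c] + S • |v| := by
    ext k; fin_cases k <;> simp
  have h0 := mul_nonneg hS (abs_nonneg (v 0))
  have h1 := mul_nonneg hS (abs_nonneg (v 1))
  have h2 := mul_nonneg hS (abs_nonneg (v 2))
  have hw : ![a, b, c] ∈ Icc (0 : Fin 3 → ℝ) 1 :=
    mem_unitCube_vec.2 ⟨⟨ha, by linarith⟩, ⟨hb, by linarith⟩, ⟨hc, by linarith⟩⟩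
  have hwS : ![a, b, c] + S • |v| ∈ Icc (0 : Fin 3 → ℝ) 1 := by
    rw [← hsum]
    exact mem_unitCube_vec.2 ⟨⟨by linarith, ha'⟩, ⟨by linarith, hb'⟩, ⟨by linarith, hc'⟩⟩
  have := follow_segment hv hγ hsing ht hS (flip_mem (v := v) hw)
    (by rw [← flip_add]; exact flip_mem hwS) h
  rw [this, ← flip_add, hsum, cubePoint]

/-- The course of a geodesic between two consecutive crossings of `y`-faces. -/
theorem follow_in_slab (hv : ∀ k, v k ≠ 0) (hγ : IsHalfInfiniteGeodesic v γ)
    (hsing : ∀ t, 0 ≤ t → γ t ∉ singular) (N : ℕ) {t S : ℝ} (ht : 0 ≤ t) (hS : 0 ≤ S) {a b c : ℝ}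
    {i : Fin 3} (ha : 0 ≤ a ∧ a ≤ 1) (hb : 0 ≤ b) (hc : 0 ≤ c ∧ c ≤ 1)
    (hb' : b + S * |v 1| ≤ 1) (hN : ⌊a + S * |v 0|⌋₊ + ⌊c + S * |v 2|⌋₊ = N)
    (h : γ t = cubePoint v ![a, b, c] i) :
    γ (t + S) = cubePoint v ![Int.fract (a + S * |v 0|), b + S * |v 1|,
      Int.fract (c + S * |v 2|)] ((glueX ^ ⌊a + S * |v 0|⌋₊) i) := by
  have hu0 : 0 < |v 0| := abs_pos.2 (hv 0)
  have hu2 : 0 < |v 2| := abs_pos.2 (hv 2)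
  have hu1 : 0 < |v 1| := abs_pos.2 (hv 1)
  -- Induction on the total number of x- and z-faces crossed: the geodesic is followed to the nearer
  -- one and restarted behind it.
  induction N generalizing t S a b c i with
  | zero =>
    have h0 : ⌊a + S * |v 0|⌋₊ = 0 := by omega
    have h2 : ⌊c + S * |v 2|⌋₊ = 0 := by omega
    have h0' := Nat.floor_eq_zero.1 h0
    have h2' := Nat.floor_eq_zero.1 h2
    rw [h0, pow_zero, Int.fract_eq_self.2 ⟨by nlinarith, h0'⟩,
      Int.fract_eq_self.2 ⟨by nlinarith, h2'⟩]
    exact follow_in_cube hv hγ hsing ht hS ha.1 hb hc.1 h0'.le hb' h2'.le h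
  | succ N ih =>
    set s0 := (1 - a) / |v 0| with hs0
    set s2 := (1 - c) / |v 2| with hs2
    have e0 : s0 * |v 0| = 1 - a := div_mul_cancel₀ _ hu0.ne'
    have e2 : s2 * |v 2| = 1 - c := div_mul_cancel₀ _ hu2.ne'
    have hs0n : 0 ≤ s0 := div_nonneg (by linarith [ha.2]) hu0.le
    have hs2n : 0 ≤ s2 := div_nonneg (by linarith [hc.2]) hu2.le
    have hfl0 : 1 ≤ ⌊a + S * |v 0|⌋₊ ↔ s0 ≤ S := by
      rw [Nat.one_le_floor_iff, hs0, div_le_iff₀ hu0, sub_le_iff_le_add']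
    have hfl2 : 1 ≤ ⌊c + S * |v 2|⌋₊ ↔ s2 ≤ S := by
      rw [Nat.one_le_floor_iff, hs2, div_le_iff₀ hu2, sub_le_iff_le_add']
    have hor : s0 ≤ S ∨ s2 ≤ S := by rw [← hfl0, ← hfl2]; omega
    -- In case of a tie one face is crossed and the other coordinate is left equal to 1, which the
    -- closed bounds allow; the next crossing then takes time 0.
    rcases le_total s0 s2 with h02 | h02
    · have hs0S : s0 ≤ S := hor.elim id h02.trans
      have hc1 : c + s0 * |v 2| ≤ 1 := by nlinarith
      have hb1 : b + s0 * |v 1| ≤ 1 := by nlinarith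
      have hc0 : 0 ≤ c + s0 * |v 2| := by nlinarith [hc.1]
      have hb0 : 0 ≤ b + s0 * |v 1| := by nlinarith
      have h1 := follow_in_cube hv hγ hsing ht hs0n ha.1 hb hc.1 (by linarith) hb1 hc1 h
      rw [e0, add_sub_cancel, cubePoint_glueX v ⟨hb0, hb1⟩ ⟨hc0, hc1⟩] at h1
      have ea : 0 + (S - s0) * |v 0| = a + S * |v 0| - 1 := by linarith
      have eb : b + s0 * |v 1| + (S - s0) * |v 1| = b + S * |v 1| := by ring
      have ec : c + s0 * |v 2| + (S - s0) * |v 2| = c + S * |v 2| := by ring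
      have hfl := hfl0.2 hs0S
      have hsub : ⌊a + S * |v 0| - 1⌋₊ = ⌊a + S * |v 0|⌋₊ - 1 := Nat.floor_sub_one _
      have h3 := ih (S := S - s0) (by linarith) (by linarith) ⟨le_rfl, zero_le_one⟩ hb0 ⟨hc0, hc1⟩
        (by linarith) (by rw [ea, ec, hsub]; omega) h1
      rw [ea, eb, ec, hsub, Int.fract_sub_one, show t + s0 + (S - s0) = t + S by ring,
        ← Equiv.Perm.mul_apply, ← pow_succ, Nat.sub_add_cancel hfl] at h3
      exact h3
    · have hs2S : s2 ≤ S := hor.elim h02.trans id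
      have ha1 : a + s2 * |v 0| ≤ 1 := by nlinarith
      have hb1 : b + s2 * |v 1| ≤ 1 := by nlinarith
      have ha0 : 0 ≤ a + s2 * |v 0| := by nlinarith [ha.1]
      have hb0 : 0 ≤ b + s2 * |v 1| := by nlinarith
      have h1 := follow_in_cube hv hγ hsing ht hs2n ha.1 hb hc.1 ha1 hb1 (by linarith) h
      rw [e2, add_sub_cancel, cubePoint_glueZ v ⟨ha0, ha1⟩ ⟨hb0, hb1⟩] at h1
      have ec : 0 + (S - s2) * |v 2| = c + S * |v 2| - 1 := by linarith
      have eb : b + s2 * |v 1| + (S - s2) * |v 1| = b + S * |v 1| := by ring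
      have ea : a + s2 * |v 0| + (S - s2) * |v 0| = a + S * |v 0| := by ring
      have hfl := hfl2.2 hs2S
      have hsub : ⌊c + S * |v 2| - 1⌋₊ = ⌊c + S * |v 2|⌋₊ - 1 := Nat.floor_sub_one _
      have h3 := ih (S := S - s2) (by linarith) (by linarith) ⟨ha0, ha1⟩ hb0 ⟨le_rfl, zero_le_one⟩
        (by linarith) (by rw [ea, ec, hsub]; omega) h1
      rwa [ea, eb, ec, Int.fract_sub_one, show t + s2 + (S - s2) = t + S by ring] at h3

/-- The point at height `s` on the geodesic with direction `v` through the point `e` of the section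
`y ∈ ℤ`. -/
def slabPoint (v : Fin 3 → ℝ) (s : ℝ) (e : UnitAddTorus (Fin 2) × Fin 3) : Manifold :=
  cubePoint v ![rep (e.1 0 + (s * (|v 0| / |v 1|) : ℝ)), s, rep (e.1 1 + (s * (|v 2| / |v 1|) : ℝ))]
    ((glueX ^ ⌊rep (e.1 0) + s * (|v 0| / |v 1|)⌋₊) e.2)

theorem follow_from_section (hv : ∀ k, v k ≠ 0) (hγ : IsHalfInfiniteGeodesic v γ)
    (hsing : ∀ t, 0 ≤ t → γ t ∉ singular) {t s : ℝ} (ht : 0 ≤ t) (hs : 0 ≤ s) (hs1 : s ≤ 1)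
    {e : UnitAddTorus (Fin 2) × Fin 3}
    (h : γ t = cubePoint v ![rep (e.1 0), 0, rep (e.1 1)] e.2) :
    γ (t + s / |v 1|) = slabPoint v s e := by
  have hu1 : 0 < |v 1| := abs_pos.2 (hv 1)
  have e1 : s / |v 1| * |v 1| = s := div_mul_cancel₀ _ hu1.ne'
  have := follow_in_slab hv hγ hsing _ (S := s / |v 1|) ht (by positivity)
    ⟨rep_nonneg _, (rep_lt_one _).le⟩ le_rfl ⟨rep_nonneg _, (rep_lt_one _).le⟩
    (by rw [e1]; linarith) rfl h
  rw [this, e1, slabPoint, rep_add_coe, rep_add_coe, zero_add, div_mul_eq_mul_div,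
    div_mul_eq_mul_div, mul_div_assoc, mul_div_assoc]

theorem slabPoint_one (v : Fin 3 → ℝ) (e : UnitAddTorus (Fin 2) × Fin 3) :
    slabPoint v 1 e = cubePoint v
      ![rep ((step (|v 0| / |v 1|) (|v 2| / |v 1|) e).1 0), 0,
        rep ((step (|v 0| / |v 1|) (|v 2| / |v 1|) e).1 1)]
      (step (|v 0| / |v 1|) (|v 2| / |v 1|) e).2 := by
  rw [slabPoint, cubePoint_glueY v ⟨rep_nonneg _, (rep_lt_one _).le⟩
    ⟨rep_nonneg _, (rep_lt_one _).le⟩]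
  simp only [step, cocycle, add_shift_zero, add_shift_one, one_mul, Equiv.Perm.mul_apply]

/-- The course of a geodesic is governed by the first return map to the section. -/
theorem exists_section_orbit (hv : ∀ k, v k ≠ 0) (hγ : IsHalfInfiniteGeodesic v γ)
    (hsing : ∀ t, 0 ≤ t → γ t ∉ singular) :
    ∃ (t₀ : ℝ) (e : UnitAddTorus (Fin 2) × Fin 3), 0 ≤ t₀ ∧ ∀ (n : ℕ) (s : ℝ), 0 ≤ s → s ≤ 1 →
      γ (t₀ + (n + s) / |v 1|) =
        slabPoint v s ((step (|v 0| / |v 1|) (|v 2| / |v 1|))^[n] e) := by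
  have hu1 : 0 < |v 1| := abs_pos.2 (hv 1)
  obtain ⟨a, b, c, i, ha, hb, hc, h⟩ := exists_cubePoint v (γ 0)
  -- `(1 - b) / |v 1|` is the time at which the geodesic first reaches the y-face at adapted height
  -- 1.
  have hS : 0 ≤ (1 - b) / |v 1| := div_nonneg (by linarith [hb.2]) hu1.le
  have e1 : b + (1 - b) / |v 1| * |v 1| = 1 := by rw [div_mul_cancel₀ _ hu1.ne']; ring
  have h1 := follow_in_slab hv hγ hsing _ le_rfl hS ha hb.1 hc e1.le rfl h
  rw [e1, cubePoint_glueY v ⟨Int.fract_nonneg _, (Int.fract_lt_one _).le⟩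
    ⟨Int.fract_nonneg _, (Int.fract_lt_one _).le⟩, zero_add, ← rep_coe, ← rep_coe] at h1
  obtain ⟨e, he⟩ : ∃ e : UnitAddTorus (Fin 2) × Fin 3, γ ((1 - b) / |v 1|) =
      cubePoint v ![rep (e.1 0), 0, rep (e.1 1)] e.2 := ⟨(![_, _], _), h1⟩
  refine ⟨(1 - b) / |v 1|, e, hS, ?_⟩
  have key : ∀ n : ℕ, γ ((1 - b) / |v 1| + n / |v 1|) = cubePoint v
      ![rep (((step (|v 0| / |v 1|) (|v 2| / |v 1|))^[n] e).1 0), 0,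
        rep (((step (|v 0| / |v 1|) (|v 2| / |v 1|))^[n] e).1 1)]
      ((step (|v 0| / |v 1|) (|v 2| / |v 1|))^[n] e).2 := by
    intro n
    induction n with
    | zero => simpa using he
    | succ n ih =>
      have := follow_from_section hv hγ hsing (by positivity) zero_le_one le_rfl ih
      rw [slabPoint_one, ← Function.iterate_succ_apply' (step _ _)] at this
      rw [← this]
      push_cast
      ring_nf
  intro n s hs hs1
  have := follow_from_section hv hγ hsing (by positivity) hs hs1 (key n)
  rw [← this]
  ring_nf

/-! ### Time averages over complete returns, and continuity along geodesics. -/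

/-- Time averages of a continuous bounded function can be computed along a subdivision of the time
axis into intervals of equal length. -/
theorem tendsto_time_average {F : ℝ → ℝ} (hF : Continuous F) {C u t₀ L : ℝ} (hC : ∀ t, |F t| ≤ C)
    (hu : 0 < u) (h : Tendsto (fun N : ℕ => ∫ s in (0 : ℝ)..1, (1 / ((N + 1 : ℕ) : ℝ)) *
      ∑ n ∈ Finset.range (N + 1), F (t₀ + (n + s) / u)) atTop (𝓝 L)) :
    Tendsto (fun T : ℝ => (1 / T) * ∫ t in (0 : ℝ)..T, F t) atTop (𝓝 L) := by
  have hii : ∀ a b, IntervalIntegrable F volume a b := fun a b => hF.intervalIntegrable a b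
  have hsum : ∀ N : ℕ, (∫ s in (0 : ℝ)..1, (1 / ((N + 1 : ℕ) : ℝ)) *
      ∑ n ∈ Finset.range (N + 1), F (t₀ + (n + s) / u)) =
      u / ((N + 1 : ℕ) : ℝ) * ∫ t in t₀..(t₀ + ((N + 1 : ℕ) : ℝ) / u), F t := by
    intro N
    rw [intervalIntegral.integral_const_mul, intervalIntegral.integral_finsetSum fun n _ =>
      (Continuous.intervalIntegrable (by fun_prop) _ _)]
    have h1 : ∀ n : ℕ, ∫ s in (0 : ℝ)..1, F (t₀ + (n + s) / u) =
        u * ∫ t in (t₀ + (n : ℝ) / u)..(t₀ + ((n + 1 : ℕ) : ℝ) / u), F t := by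
      intro n
      have h2 := intervalIntegral.integral_comp_add_div (a := 0) (b := 1) F hu.ne' (t₀ + n / u)
      rw [smul_eq_mul] at h2
      have h3 : t₀ + (n : ℝ) / u + 0 / u = t₀ + n / u := by ring
      have h4 : t₀ + (n : ℝ) / u + 1 / u = t₀ + ((n + 1 : ℕ) : ℝ) / u := by push_cast; ring
      rw [h3, h4] at h2
      rw [← h2]
      congr 1
      ext s
      congr 1
      ring
    simp_rw [h1]
    rw [← Finset.mul_sum, intervalIntegral.sum_integral_adjacent_intervals
      (a := fun n : ℕ => t₀ + (n : ℝ) / u) fun k _ => hii _ _]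
    simp only [Nat.cast_zero, zero_div, add_zero]
    ring
  simp_rw [hsum] at h
  -- `M T` counts the complete intervals of length `1 / u` in `[t₀, T]`. What remains is `[0, t₀]`
  -- and a piece of length at most `1 / u`, negligible after division by `T`.
  set M : ℝ → ℕ := fun T => ⌊(T - t₀) * u⌋₊ with hM
  have hx : Tendsto (fun T : ℝ => (T - t₀) * u) atTop atTop :=
    (tendsto_atTop_add_const_right _ _ tendsto_id).atTop_mul_const hu
  have hMt : Tendsto M atTop atTop := tendsto_nat_floor_atTop.comp hx
  have hB : Tendsto (fun T => u / (M T : ℝ) * ∫ t in t₀..(t₀ + (M T : ℝ) / u), F t)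
      atTop (𝓝 L) :=
    ((tendsto_add_atTop_iff_nat
      (f := fun n : ℕ => u / (n : ℝ) * ∫ t in t₀..(t₀ + (n : ℝ) / u), F t) 1).1 h).comp hMt
  have hinv : Tendsto (fun T : ℝ => 1 / T) atTop (𝓝 0) := by
    simpa using tendsto_inv_atTop_zero (𝕜 := ℝ)
  have hratio : Tendsto (fun T => (M T : ℝ) / (u * T)) atTop (𝓝 1) := by
    have h1 : Tendsto (fun T => (M T : ℝ) / ((T - t₀) * u)) atTop (𝓝 1) :=
      tendsto_nat_floor_div_atTop.comp hx
    have h2 : Tendsto (fun T : ℝ => 1 - t₀ * (1 / T)) atTop (𝓝 1) := by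
      simpa using (hinv.const_mul t₀).const_sub 1
    have h3 := h1.mul h2
    rw [mul_one] at h3
    refine h3.congr' ?_
    filter_upwards [eventually_gt_atTop 0, eventually_gt_atTop t₀] with T hT hT'
    have := sub_pos.2 hT'
    field_simp
  have hrest : Tendsto (fun T => (1 / T) * ((∫ t in (0 : ℝ)..t₀, F t) +
      ∫ t in (t₀ + (M T : ℝ) / u)..T, F t)) atTop (𝓝 0) := by
    have h1 : Tendsto (fun T : ℝ => (C * |t₀| + C * (1 / u)) * (1 / T)) atTop (𝓝 0) := by
      simpa using hinv.const_mul (C * |t₀| + C * (1 / u))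
    refine squeeze_zero_norm' ?_ h1
    filter_upwards [eventually_gt_atTop 0, eventually_gt_atTop t₀] with T hT hT'
    have hC0 : 0 ≤ C := (abs_nonneg _).trans (hC 0)
    have h2 : ‖∫ t in (0 : ℝ)..t₀, F t‖ ≤ C * |t₀ - 0| :=
      intervalIntegral.norm_integral_le_of_norm_le_const fun t _ => hC t
    have h3 : ‖∫ t in (t₀ + (M T : ℝ) / u)..T, F t‖ ≤ C * |T - (t₀ + (M T : ℝ) / u)| :=
      intervalIntegral.norm_integral_le_of_norm_le_const fun t _ => hC t
    have h4 : |T - (t₀ + (M T : ℝ) / u)| ≤ 1 / u := by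
      have h5 := Nat.floor_le (mul_nonneg (sub_pos.2 hT').le hu.le)
      have h6 := Nat.lt_floor_add_one ((T - t₀) * u)
      have h7 : (M T : ℝ) / u ≤ T - t₀ := (div_le_iff₀ hu).2 h5
      have h8 : T - t₀ < ((M T : ℝ) + 1) / u := (lt_div_iff₀ hu).2 h6
      rw [add_div] at h8
      rw [abs_le]
      constructor <;> linarith [one_div_pos.2 hu]
    rw [norm_mul, Real.norm_of_nonneg (one_div_pos.2 hT).le, mul_comm]
    refine mul_le_mul_of_nonneg_right ((norm_add_le _ _).trans ?_) (one_div_pos.2 hT).le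
    rw [sub_zero] at h2
    exact add_le_add h2 (h3.trans (mul_le_mul_of_nonneg_left h4 hC0))
  have := (hB.mul hratio).add hrest
  rw [mul_one, add_zero] at this
  refine this.congr' ?_
  filter_upwards [eventually_gt_atTop 0, hMt.eventually_ge_atTop 1] with T hT hM1
  have hM0 : (M T : ℝ) ≠ 0 := by positivity
  rw [← intervalIntegral.integral_add_adjacent_intervals (hii 0 (t₀ + (M T : ℝ) / u)) (hii _ T),
    ← intervalIntegral.integral_add_adjacent_intervals (hii 0 t₀) (hii t₀ (t₀ + (M T : ℝ) / u))]
  field_simp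
  ring

theorem continuous_proj : Continuous proj := continuous_quot_mk

theorem isClosed_solid : IsClosed solid :=
  (isClosed_Icc.union isClosed_Icc).union isClosed_Icc

theorem isCompact_solid : IsCompact solid :=
  (isCompact_Icc.union isCompact_Icc).union isCompact_Icc

theorem exists_abs_le (f : C(Manifold, ℝ)) : ∃ C, ∀ m, |f m| ≤ C := by
  have : CompactSpace solid := isCompact_iff_compactSpace.1 isCompact_solid
  obtain ⟨C, hC⟩ := (isCompact_range (f.continuous.comp continuous_proj)).isBounded.exists_norm_le
  refine ⟨C, fun m => ?_⟩
  obtain ⟨p, rfl⟩ := Quot.exists_rep m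
  exact hC _ ⟨p, rfl⟩

theorem continuousOn_comp_projExt (f : C(Manifold, ℝ)) :
    ContinuousOn (fun q => f (projExt q)) solid := by
  rw [continuousOn_iff_continuous_domRestrict]
  refine (f.continuous.comp continuous_proj).congr fun p => ?_
  rw [domRestrict_apply, projExt_of_mem p.2]
  rfl

theorem continuousOn_geodesic {v : Fin 3 → ℝ} {γ : ℝ → Manifold}
    (hγ : IsHalfInfiniteGeodesic v γ) (f : C(Manifold, ℝ)) :
    ContinuousOn (fun t => f (γ t)) (Ici 0) := by
  have hseg : ∀ a b, StraightOn v γ a b → ContinuousOn (fun t => f (γ t)) (Icc a b) := by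
    rintro a b ⟨q, hq⟩
    have h1 : ContinuousOn (fun t : ℝ => f (projExt (q + (t - a) • v))) (Icc a b) :=
      (continuousOn_comp_projExt f).comp (by fun_prop) fun t ht => (hq t ht).1
    refine h1.congr fun t ht => ?_
    obtain ⟨h2, h3⟩ := hq t ht
    rw [h3, ← projExt_of_mem]
  have hright : ∀ t, 0 ≤ t → ContinuousWithinAt (fun t => f (γ t)) (Ici t) t := by
    intro t ht
    obtain ⟨b, hb, hs⟩ := hγ.1 t ht
    exact (hseg _ _ hs t ⟨le_rfl, hb.le⟩).mono_of_mem_nhdsWithin (Icc_mem_nhdsGE hb)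
  intro t ht
  rcases (mem_Ici.1 ht).eq_or_lt with rfl | ht'
  · exact hright _ le_rfl
  · obtain ⟨a, -, ha, hs⟩ := hγ.2 t ht'
    refine (continuousAt_iff_continuous_left_right.2 ⟨?_, hright t ht⟩).continuousWithinAt
    exact (hseg _ _ hs t ⟨ha.le, le_rfl⟩).mono_of_mem_nhdsWithin (Icc_mem_nhdsLE ha)

/-! ### Slice averages and the integral over the manifold. -/

/-- Continuous extension to all of space of a continuous function on a cube of the manifold. -/
def cubeFun (f : C(Manifold, ℝ)) (v : Fin 3 → ℝ) (i : Fin 3) (w : Fin 3 → ℝ) : ℝ :=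
  f (cubePoint v (fun k => max 0 (min 1 (w k))) i)

theorem clamp_mem (w : Fin 3 → ℝ) :
    (fun k => max 0 (min 1 (w k))) ∈ Icc (0 : Fin 3 → ℝ) 1 := by
  rw [mem_unitCube]
  exact fun k => ⟨le_max_left _ _, max_le zero_le_one (min_le_left _ _)⟩

theorem continuous_flip (v : Fin 3 → ℝ) : Continuous (flip v) := by
  refine continuous_pi fun k => ?_
  unfold flip
  split_ifs <;> fun_prop

theorem continuous_cubeFun (f : C(Manifold, ℝ)) (v : Fin 3 → ℝ) (i : Fin 3) :
    Continuous (cubeFun f v i) := by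
  have h : Continuous fun w : Fin 3 → ℝ => flip v (fun k => max 0 (min 1 (w k))) + corner i :=
    ((continuous_flip v).comp (by fun_prop)).add continuous_const
  exact (continuousOn_comp_projExt f).comp_continuous h fun w =>
    add_corner_mem (flip_mem (clamp_mem w)) i

theorem cubeFun_eq (f : C(Manifold, ℝ)) (v : Fin 3 → ℝ) (i : Fin 3) {w : Fin 3 → ℝ}
    (hw : w ∈ Icc (0 : Fin 3 → ℝ) 1) : cubeFun f v i w = f (cubePoint v w i) := by
  have h : (fun k => max 0 (min 1 (w k))) = w := by
    ext k
    have := mem_unitCube.1 hw k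
    rw [min_eq_right this.2, max_eq_right this.1]
  rw [cubeFun, h]

theorem comp_slabPoint (f : C(Manifold, ℝ)) (v : Fin 3 → ℝ) {s : ℝ} (hs : 0 ≤ s) (hs1 : s ≤ 1)
    (e : UnitAddTorus (Fin 2) × Fin 3) :
    f (slabPoint v s e) = cubeFun f v ((glueX ^ ⌊rep (e.1 0) + s * (|v 0| / |v 1|)⌋₊) e.2)
      ![rep (e.1 0 + (s * (|v 0| / |v 1|) : ℝ)), s,
        rep (e.1 1 + (s * (|v 2| / |v 1|) : ℝ))] := by
  rw [cubeFun_eq, slabPoint]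
  exact mem_unitCube_vec.2 ⟨⟨rep_nonneg _, (rep_lt_one _).le⟩, ⟨hs, hs1⟩,
    ⟨rep_nonneg _, (rep_lt_one _).le⟩⟩

/-- The space average over the slice of the manifold at height `s`. -/
def sliceIntegral (f : C(Manifold, ℝ)) (v : Fin 3 → ℝ) (s : ℝ) : ℝ :=
  ∫ p : UnitAddTorus (Fin 2), ∑ i, cubeFun f v i ![rep (p 0), s, rep (p 1)]

theorem measurable_slice (s : ℝ) (a : UnitAddTorus (Fin 2)) :
    Measurable fun p : UnitAddTorus (Fin 2) => ![rep (p 0 + a 0), s, rep (p 1 + a 1)] := by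
  refine measurable_pi_lambda _ fun k => ?_
  fin_cases k
  · exact measurable_rep.comp ((measurable_pi_apply 0).add_const _)
  · exact measurable_const
  · exact measurable_rep.comp ((measurable_pi_apply 1).add_const _)

theorem measurable_finite_family_comp {X : Type*} [MeasurableSpace X]
    {h : Fin 3 → (Fin 3 → ℝ) → ℝ} (hh : ∀ i, Continuous (h i)) {i : X → Fin 3}
    (hi : Measurable i) {w : X → Fin 3 → ℝ} (hw : Measurable w) :
    Measurable fun x => h (i x) (w x) := by
  have h1 : Measurable fun q : Fin 3 × (Fin 3 → ℝ) => h q.1 q.2 :=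
    measurable_from_prod_countable_right fun i => (hh i).measurable
  exact h1.comp (hi.prodMk hw)

theorem measurable_glued_slice (f : C(Manifold, ℝ)) (v : Fin 3 → ℝ) (s r : ℝ)
    (a : UnitAddTorus (Fin 2)) :
    Measurable fun e : UnitAddTorus (Fin 2) × Fin 3 =>
      cubeFun f v ((glueX ^ ⌊rep (e.1 0) + r⌋₊) e.2)
        ![rep (e.1 0 + a 0), s, rep (e.1 1 + a 1)] := by
  have h2 : Measurable fun e : UnitAddTorus (Fin 2) × Fin 3 => rep (e.1 0) + r :=
    (measurable_rep.comp ((measurable_pi_apply 0).comp measurable_fst)).add_const _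
  have h4 : Measurable fun e : UnitAddTorus (Fin 2) × Fin 3 =>
      (glueX ^ ⌊rep (e.1 0) + r⌋₊) e.2 :=
    (measurable_of_countable fun q : ℕ × Fin 3 => (glueX ^ q.1) q.2).comp
      ((Nat.measurable_floor.comp h2).prodMk measurable_snd)
  exact measurable_finite_family_comp (continuous_cubeFun f v) h4
    ((measurable_slice s a).comp measurable_fst)

/-- The function on the section is bounded, and it can be discontinuous only where the start or the
shifted point has `x = 0`, or the shifted point has `z = 0`, modulo 1. These sets are null, so
equidistribution applies. -/
theorem tendsto_slice_average {v : Fin 3 → ℝ} (f : C(Manifold, ℝ)) (hv : ∀ k, v k ≠ 0)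
    (hα : Irrational (|v 0| / |v 1|))
    (ha : ∀ k : Fin 2 → ℤ, k ≠ 0 →
      UnitAddTorus.mFourier k (shift (|v 0| / |v 1|) (|v 2| / |v 1|)) ≠ 1)
    {s : ℝ} (hs : 0 ≤ s) (hs1 : s ≤ 1) (e : UnitAddTorus (Fin 2) × Fin 3) :
    Tendsto (fun N : ℕ => (1 / ((N + 1 : ℕ) : ℝ)) * ∑ n ∈ Finset.range (N + 1),
      f (slabPoint v s ((step (|v 0| / |v 1|) (|v 2| / |v 1|))^[n] e))) atTop
      (𝓝 ((1 / 3) * sliceIntegral f v s)) := by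
  obtain ⟨C, hC⟩ := exists_abs_le f
  set α := |v 0| / |v 1| with hαdef
  set β := |v 2| / |v 1| with hβdef
  have hα0 : 0 < α := div_pos (abs_pos.2 (hv 0)) (abs_pos.2 (hv 1))
  set σ := shift (s * α) (s * β) with hσ
  set G : UnitAddTorus (Fin 2) × Fin 3 → ℝ := fun e => f (slabPoint v s e) with hG
  have hGeq : ∀ e, G e = cubeFun f v ((glueX ^ ⌊rep (e.1 0) + s * α⌋₊) e.2)
      ![rep (e.1 0 + σ 0), s, rep (e.1 1 + σ 1)] := fun e => comp_slabPoint f v hs hs1 e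
  have hGm : Measurable G := by
    rw [funext hGeq]
    exact measurable_glued_slice f v s (s * α) σ
  have hcontG : ∀ e, e ∉ {e : UnitAddTorus (Fin 2) × Fin 3 | e.1 0 = 0} ∪ {e | e.1 0 = -σ 0} ∪
      {e | e.1 1 = -σ 1} → ContinuousAt G e := by
    intro e he
    simp only [mem_union, mem_ofPred_eq, not_or, ← add_eq_zero_iff_eq_neg] at he
    obtain ⟨⟨h0, h1⟩, h2⟩ := he
    have hc : ∀ k, ContinuousAt (fun e : UnitAddTorus (Fin 2) × Fin 3 => e.1 k) e := fun k =>
      ((continuous_apply k).comp continuous_fst).continuousAt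
    have hev := (hc 0).eventually (eventually_floor_rep h0 (mul_nonneg hs hα0.le) h1)
    have hw : ContinuousAt (fun e : UnitAddTorus (Fin 2) × Fin 3 =>
        ![rep (e.1 0 + σ 0), s, rep (e.1 1 + σ 1)]) e := by
      refine continuousAt_pi.2 fun k => ?_
      fin_cases k
      · exact ContinuousAt.comp (f := fun e : UnitAddTorus (Fin 2) × Fin 3 => e.1 0 + σ 0)
          (continuousAt_rep h1) ((hc 0).add continuousAt_const)
      · exact continuousAt_const
      · exact ContinuousAt.comp (f := fun e : UnitAddTorus (Fin 2) × Fin 3 => e.1 1 + σ 1)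
          (continuousAt_rep h2) ((hc 1).add continuousAt_const)
    have hi : ∀ᶠ e' in 𝓝 e, e'.2 = e.2 :=
      continuous_snd.continuousAt.preimage_mem_nhds ((isOpen_discrete {e.2}).mem_nhds rfl)
    refine ((continuous_cubeFun f v ((glueX ^ ⌊rep (e.1 0) + s * α⌋₊)
      e.2)).continuousAt.comp hw).congr ?_
    filter_upwards [hev, hi] with e' h3 h4
    rw [hGeq, h3, h4]
    rfl
  have hlim := tendsto_integral_of_continuousAt_off (tendsto_empirical hα0 hα ha e) hGm
    (fun e => hC _) (((coord_isClosed 0 0).union (coord_isClosed 0 (-σ 0))).union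
      (coord_isClosed 1 (-σ 1)))
    (measure_union_null (measure_union_null (sectionMeasure_coord_eq _ _)
      (sectionMeasure_coord_eq _ _)) (sectionMeasure_coord_eq _ _)) hcontG
  simp_rw [integral_empirical] at hlim
  convert hlim using 2
  change _ = ∫ e, G e ∂sectionMeasure
  have hGint : Integrable G sectionMeasure :=
    Integrable.of_bound hGm.aestronglyMeasurable C (ae_of_all _ fun e => hC _)
  rw [sectionMeasure, integral_prod _ hGint]
  simp only [fiberMeasure, integral_smul_measure, integral_count, hGeq]
  -- Translation invariance absorbs the drift `σ` between heights 0 and `s`, and over each `p` the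
  -- gluing power only permutes the three summands.
  rw [sliceIntegral, ← integral_add_right_eq_self (μ := volume) _ σ, ← integral_const_mul]
  congr 1
  ext p
  rw [Equiv.sum_comp (glueX ^ ⌊rep (p 0) + s * α⌋₊)
    fun i => cubeFun f v i ![rep (p 0 + σ 0), s, rep (p 1 + σ 1)]]
  simp

theorem measurePreserving_rep :
    MeasurePreserving rep volume (volume.restrict (Ico (0 : ℝ) 1)) := by
  refine ⟨measurable_rep, ?_⟩
  have hmk := UnitAddCircle.measurePreserving_mk 0
  rw [← hmk.map_eq, Measure.map_map measurable_rep hmk.measurable, zero_add,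
    Measure.restrict_congr_set Ico_ae_eq_Ioc]
  conv_rhs => rw [← Measure.map_id (μ := volume.restrict (Ioc (0 : ℝ) 1))]
  refine Measure.map_congr ?_
  rw [← Measure.restrict_congr_set Ico_ae_eq_Ioc]
  filter_upwards [ae_restrict_mem measurableSet_Ico] with r hr
  exact (rep_coe r).trans (Int.fract_eq_self.2 hr)

/-- Fubini's theorem for the decomposition of the cubes into slices. -/
theorem integral_sliceIntegral (f : C(Manifold, ℝ)) (v : Fin 3 → ℝ) :
    ∫ s in (0 : ℝ)..1, sliceIntegral f v s =
      ∑ i, ∫ w in Icc (0 : Fin 3 → ℝ) 1, cubeFun f v i w := by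
  obtain ⟨C, hC⟩ := exists_abs_le f
  set ρ : Measure ℝ := volume.restrict (Ico (0 : ℝ) 1) with hρ
  have : IsProbabilityMeasure ρ := ⟨by simp [hρ]⟩
  set H : (Fin 3 → ℝ) → ℝ := fun w => ∑ i, cubeFun f v i w with hH
  have hHc : Continuous H := continuous_finsetSum _ fun i _ => continuous_cubeFun f v i
  have hslice : ∀ s, sliceIntegral f v s =
      ∫ q : Fin 2 → ℝ, H ((1 : Fin 3).insertNth (α := fun _ => ℝ) s q) ∂Measure.pi fun _ => ρ := by
    intro s
    have hmp : MeasurePreserving (fun (p : UnitAddTorus (Fin 2)) k => rep (p k)) volume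
        (Measure.pi fun _ => ρ) := measurePreserving_pi _ _ fun _ => measurePreserving_rep
    have hins : Continuous fun q : Fin 2 → ℝ => (1 : Fin 3).insertNth (α := fun _ => ℝ) s q := by
      fun_prop
    rw [← hmp.map_eq, integral_map (f := fun q => H ((1 : Fin 3).insertNth (α := fun _ => ℝ) s q))
      hmp.measurable.aemeasurable
      (hHc.comp hins).aestronglyMeasurable, sliceIntegral]
    congr 1
    ext p
    have hvec : ![rep (p 0), s, rep (p 1)]
        = (1 : Fin 3).insertNth (α := fun _ => ℝ) s (fun k => rep (p k)) := by
      ext k; fin_cases k <;> rfl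
    rw [hvec]
  have hmp := (measurePreserving_piFinSuccAbove (fun _ : Fin 3 => ρ) 1).symm
  have hint : Integrable H (Measure.pi fun _ : Fin 3 => ρ) := by
    refine Integrable.of_bound hHc.aestronglyMeasurable (∑ _i : Fin 3, C) (ae_of_all _ fun w => ?_)
    exact (norm_sum_le _ _).trans (Finset.sum_le_sum fun i _ => hC _)
  have hint' := hmp.integrable_comp_of_integrable hint
  have hpi : (Measure.pi fun _ : Fin 3 => ρ) = volume.restrict (Icc (0 : Fin 3 → ℝ) 1) := by
    rw [hρ, ← Measure.restrict_pi_pi]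
    exact Measure.restrict_congr_set Measure.univ_pi_Ico_ae_eq_Icc
  calc ∫ s in (0 : ℝ)..1, sliceIntegral f v s
      = ∫ s, sliceIntegral f v s ∂ρ := by
        rw [intervalIntegral.integral_of_le zero_le_one, hρ,
          Measure.restrict_congr_set Ico_ae_eq_Ioc]
    _ = ∫ x, H ((MeasurableEquiv.piFinSuccAbove (fun _ : Fin 3 => ℝ) 1).symm x)
          ∂(ρ.prod (Measure.pi fun _ : Fin 2 => ρ)) := by
        simp_rw [hslice]
        exact (integral_prod (fun x : ℝ × (Fin 2 → ℝ) =>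
          H ((MeasurableEquiv.piFinSuccAbove (fun _ : Fin 3 => ℝ) 1).symm x)) hint').symm
    _ = ∫ w, H w ∂(Measure.pi fun _ : Fin 3 => ρ) := hmp.integral_comp' H
    _ = ∑ i, ∫ w in Icc (0 : Fin 3 → ℝ) 1, cubeFun f v i w := by
        rw [hpi, integral_finsetSum]
        exact fun i _ => (continuous_cubeFun f v i).integrableOn_Icc

theorem measurePreserving_flip (v : Fin 3 → ℝ) : MeasurePreserving (flip v) := by
  refine volume_preserving_pi (f := fun k r => if 0 < v k then r else 1 - r) fun k => ?_
  split_ifs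
  · exact MeasurePreserving.id _
  · exact Measure.measurePreserving_sub_left volume 1

/-- The cubes as subsets of space. -/
def cube (i : Fin 3) : Set (Fin 3 → ℝ) := {q | q - corner i ∈ Icc (0 : Fin 3 → ℝ) 1}

theorem isClosed_cube (i : Fin 3) : IsClosed (cube i) :=
  isClosed_Icc.preimage (continuous_id.sub continuous_const)

theorem aedisjoint_cube {i j : Fin 3} (hij : i ≠ j) :
    AEDisjoint (volume : Measure (Fin 3 → ℝ)) (cube i) (cube j) := by
  refine measure_mono_null (t := {q : Fin 3 → ℝ | q 0 = 1} ∪ {q | q 1 = 1}) ?_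
    (measure_union_null (Measure.pi_hyperplane _ _ _) (Measure.pi_hyperplane _ _ _))
  rintro q ⟨h1, h2⟩
  have a := mem_unitCube.1 h1
  have b := mem_unitCube.1 h2
  have a0 := a 0
  have a1 := a 1
  have b0 := b 0
  have b1 := b 1
  simp only [mem_union, mem_ofPred_eq, Pi.sub_apply] at *
  fin_cases i <;> fin_cases j <;> simp [corner] at * <;> grind

/-- The cubes overlap in null sets, and the translations and reflections to adapted coordinates
preserve volume. -/
theorem integral_leb (f : C(Manifold, ℝ)) (v : Fin 3 → ℝ) :
    ∫ m, f m ∂leb = ∑ i, ∫ w in Icc (0 : Fin 3 → ℝ) 1, cubeFun f v i w := by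
  have hsolid : solid = ⋃ i, cube i := by
    ext q
    rw [mem_solid_iff, mem_iUnion]
    rfl
  have hint : IntegrableOn (fun q => f (projExt q)) solid :=
    (continuousOn_comp_projExt f).integrableOn_compact isCompact_solid
  have h1 : ∫ m, f m ∂leb = ∫ q in solid, f (projExt q) := by
    rw [leb, integral_map continuous_proj.measurable.aemeasurable
      f.continuous.measurable.aestronglyMeasurable,
      ← integral_subtype_comap isClosed_solid.measurableSet]
    congr 1
    ext p
    rw [projExt_of_mem p.2]
  have hshift : ∀ i, ∫ q in cube i, f (projExt q)
      = ∫ w in Icc (0 : Fin 3 → ℝ) 1, f (projExt (w + corner i)) := by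
    intro i
    rw [← (measurePreserving_add_right volume (corner i)).setIntegral_preimage_emb
      (measurableEmbedding_addRight _) (fun q => f (projExt q)) (cube i)]
    congr 2
    ext w
    simp [cube]
  have hflip : ∀ i, ∫ w in Icc (0 : Fin 3 → ℝ) 1, f (projExt (w + corner i))
      = ∫ w in Icc (0 : Fin 3 → ℝ) 1, cubeFun f v i w := by
    intro i
    have hemb : MeasurableEmbedding (flip v) :=
      (MeasurableEquiv.mk ⟨flip v, flip v, flip_flip v, flip_flip v⟩ (continuous_flip v).measurable
        (continuous_flip v).measurable).measurableEmbedding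
    rw [← (measurePreserving_flip v).setIntegral_preimage_emb hemb
      (fun w => f (projExt (w + corner i))) (Icc 0 1)]
    have hpre : flip v ⁻¹' Icc (0 : Fin 3 → ℝ) 1 = Icc 0 1 := by
      ext w
      exact ⟨fun h => by simpa [flip_flip] using flip_mem (v := v) h, fun h => flip_mem h⟩
    rw [hpre]
    refine setIntegral_congr_fun measurableSet_Icc fun w hw => ?_
    exact (cubeFun_eq f v i hw).symm
  rw [h1, hsolid, integral_iUnion_ae (fun i => (isClosed_cube i).measurableSet.nullMeasurableSet)
    (fun i j hij => aedisjoint_cube hij) (hsolid ▸ hint), tsum_fintype]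
  exact Finset.sum_congr rfl fun i _ => (hshift i).trans (hflip i)

/-! ### Conclusion for Kronecker directions. -/

theorem IsKroneckerDirection.int_combination {v : Fin 3 → ℝ} (hv : IsKroneckerDirection v)
    (k l m : ℤ) (h : k * |v 0| + m * |v 1| + l * |v 2| = 0) : k = 0 ∧ m = 0 ∧ l = 0 := by
  have hsign : ∀ r : ℝ, ∃ ε : ℤ, ε ≠ 0 ∧ |r| = ε * r := fun r => by
    rcases abs_choice r with h | h
    · exact ⟨1, one_ne_zero, by simp [h]⟩
    · exact ⟨-1, by norm_num, by simp [h]⟩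
  obtain ⟨a, ha, ha'⟩ := hsign (v 0)
  obtain ⟨b, hb, hb'⟩ := hsign (v 1)
  obtain ⟨c, hc, hc'⟩ := hsign (v 2)
  -- The signs relating `|v k|` to `v k` are absorbed into the integer coefficients.
  have h0 := Fintype.linearIndependent_iff.1 hv ![(k * a : ℤ), (m * b : ℤ), (l * c : ℤ)] (by
    rw [Fin.sum_univ_three]
    simp only [Matrix.cons_val, Rat.smul_def]
    rw [ha', hb', hc'] at h
    push_cast
    linarith)
  have e0 := h0 0
  have e1 := h0 1
  have e2 := h0 2
  simp [ha, hb, hc] at e0 e1 e2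
  exact ⟨e0, e1, e2⟩

theorem isUniformlyDistributed_of_isKroneckerDirection {v : Fin 3 → ℝ} (hv : IsKroneckerDirection v)
    {γ : ℝ → Manifold} (hγ : IsHalfInfiniteGeodesic v γ) (hsing : ∀ t, 0 ≤ t → γ t ∉ singular) :
    IsUniformlyDistributed γ := by
  intro f
  have hv0 : ∀ k, v k ≠ 0 := fun k => hv.ne_zero k
  have hu1 : 0 < |v 1| := abs_pos.2 (hv0 1)
  have hchar : ∀ k l m : ℤ, k * (|v 0| / |v 1|) + l * (|v 2| / |v 1|) + m = 0 →
      k = 0 ∧ l = 0 := by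
    intro k l m h
    have h1 : k * |v 0| + m * |v 1| + l * |v 2| = 0 := by
      field_simp at h
      linarith
    have h2 := hv.int_combination k l m h1
    exact ⟨h2.1, h2.2.2⟩
  have hirr : Irrational (|v 0| / |v 1|) := by
    rintro ⟨q, hq⟩
    have h1 := hchar q.den 0 (-q.num) (by
      rw [← hq]
      have : (q.den : ℝ) * q = q.num := by exact_mod_cast Rat.den_mul_eq_num q
      push_cast
      linarith)
    exact q.den_nz (by exact_mod_cast h1.1)
  obtain ⟨C, hC⟩ := exists_abs_le f
  obtain ⟨t₀, e, ht₀, he⟩ := exists_section_orbit hv0 hγ hsing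
  -- Since `γ` is arbitrary at negative times, it is frozen at its initial value there to give a
  -- continuous function on the line.
  set F : ℝ → ℝ := fun t => f (γ (max t 0)) with hF
  have hFc : Continuous F := (continuousOn_geodesic hγ f).comp_continuous (by fun_prop)
    fun t => le_max_right t 0
  have hFγ : ∀ t, 0 ≤ t → F t = f (γ t) := fun t ht => by rw [hF]; simp only [max_eq_left ht]
  have hslab : ∀ (n : ℕ) (s : ℝ), 0 ≤ s → s ≤ 1 → F (t₀ + (n + s) / |v 1|) =
      f (slabPoint v s ((step (|v 0| / |v 1|) (|v 2| / |v 1|))^[n] e)) := by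
    intro n s hs hs1
    rw [hFγ _ (by positivity), he n s hs hs1]
  -- The averages converge for each height `s` and are bounded by `C`, so dominated convergence
  -- allows integration over `s`.
  have hmain : Tendsto (fun N : ℕ => ∫ s in (0 : ℝ)..1, (1 / ((N + 1 : ℕ) : ℝ)) *
      ∑ n ∈ Finset.range (N + 1), F (t₀ + (n + s) / |v 1|)) atTop
      (𝓝 (∫ s in (0 : ℝ)..1, (1 / 3) * sliceIntegral f v s)) := by
    refine intervalIntegral.tendsto_integral_filter_of_dominated_convergence (fun _ => C)
      (Eventually.of_forall fun N => ?_) (Eventually.of_forall fun N => ae_of_all _ fun s _ => ?_)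
      intervalIntegrable_const (ae_of_all _ fun s hs => ?_)
    · exact Continuous.aestronglyMeasurable (by fun_prop)
    · have hN : (0 : ℝ) < ((N + 1 : ℕ) : ℝ) := by positivity
      rw [norm_mul, Real.norm_of_nonneg (one_div_pos.2 hN).le, one_div, inv_mul_le_iff₀ hN]
      refine (norm_sum_le _ _).trans ((Finset.sum_le_sum fun n _ => hC _).trans_eq ?_)
      simp
    · rw [uIoc_of_le zero_le_one] at hs
      refine (tendsto_slice_average f hv0 hirr (mFourier_ne_one hchar) hs.1.le hs.2 e).congr
        fun N => ?_
      congr 1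
      exact Finset.sum_congr rfl fun n _ => (hslab n s hs.1.le hs.2).symm
  rw [intervalIntegral.integral_const_mul, integral_sliceIntegral, ← integral_leb] at hmain
  refine (tendsto_time_average hFc (C := C) (fun t => hC _) hu1 hmain).congr' ?_
  filter_upwards [eventually_ge_atTop 0] with T hT
  congr 1
  refine intervalIntegral.integral_congr fun t ht => ?_
  rw [uIcc_of_le hT] at ht
  exact hFγ t ht.1

end LManifold

end

theorem theorem1 (v : Fin 3 → ℝ) (hv : LManifold.IsKroneckerDirection v)
    (γ : ℝ → LManifold.Manifold) (hγ : LManifold.IsHalfInfiniteGeodesic v γ)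
    (hsing : ∀ t, 0 ≤ t → γ t ∉ LManifold.singular) :
    LManifold.IsUniformlyDistributed γ :=
  LManifold.isUniformlyDistributed_of_isKroneckerDirection hv hγ hsing
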